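/- Let $L,E,b>0$, let $0=y_1<\dots<y_{r+1}=L$, and let the thickness $t$ be equal to a constant $t_j>0$ on each open segment $(y_j,y_{j+1})$. Consider the clamped Euler--Bernoulli beam of length $L$ with constant Young's modulus $E$, rectangular cross-section of constant width $b$ and thickness $t(x)$, that is, with bending stiffness $EI(x)=E\,b\,t(x)^3/12$. Let $$V=H^2_0(0,L)=\{v\in H^2(0,L): v(0)=v'(0)=v(L)=v'(L)=0\},\qquad \hat a(u,v)=\int_0^L t^3u''v''\,dx,\qquad b(u,v)=\int_0^L u'v'\,dx .$$ Let $0=x_1<\dots<x_{N+1}=L$ be a finite element mesh that is aligned with the steps (every $y_j$ is one of the $x_k$), and let $V_h$ be the cubic Hermite space of all $v\in V$ that are polynomials of degree at most $3$ on each $[x_k,x_{k+1}]$. The problem of finding $\lambda\in\mathbb R$ and $0\ne u\in V$ with $\hat a(u,v)=\lambda\, b(u,v)$ for all $v\in V$ has a nondecreasing sequence of eigenvalues $\lambda_1\le\lambda_2\le\cdots$, and the discrete problem of finding $\lambda_h\in\mathbb R$ and $0\ne u_h\in V_h$ with $\hat a(u_h,v_h)=\lambda_h\, b(u_h,v_h)$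 for all $v_h\in V_h$ has eigenvalues $\lambda_{h,1}\le\dots\le\lambda_{h,\dim V_h}$, all of them listed according to multiplicity. They are the scaled buckling loads $\lambda_i=12P_i/(Eb)$ and $\lambda_{h,i}=12P_{h,i}/(Eb)$, where $P_i$ and $P_{h,i}$ are the eigenvalues, listed in the same way, of the same two problems with $\hat a(u,v)$ replaced by $\int_0^L EI\,u''v''\,dx$. Moreover $$\frac{\lambda_{h,i}}{1+\lambda_{h,i}\widehat C_h^2}\le\lambda_i\le\lambda_{h,i}\qquad\text{for all } i=1,\dots,\dim V_h,\qquad\text{where}\quad \widehat C_h^2=\frac1{4\pi^2}\max_{1\le k\le N}\frac{h_k^2}{t_k^3},$$ $h_k=x_{k+1}-x_k$, and in this formula $t_k$ is the constant value of $t$ on the element $(x_k,x_{k+1})$. -/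

import Mathlib

open MeasureTheory Set
open scoped ContDiff Polynomial

namespace Beam

/-- The real Lebesgue space `L²(0, L)`. -/
abbrev L2 (L : ℝ) : Type := Lp ℝ 2 (volume.restrict (Ioo (0 : ℝ) L))

/-- `g ∈ L²(0, L)` is the generalized (weak) derivative of `u ∈ L²(0, L)`: integration by parts
holds against every smooth function with compact support in `(0, L)`. -/
def HasWeakDeriv {L : ℝ} (u g : L2 L) : Prop :=
  ∀ φ : ℝ → ℝ, ContDiff ℝ ∞ φ → HasCompactSupport φ → tsupport φ ⊆ Ioo 0 L →
    ∫ s in Ioo 0 L, u s * deriv φ s = -∫ s in Ioo 0 L, g s * φ s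

/-- The continuous representative of `u` on `[0, L]` exists and vanishes at both end points. -/
def VanishesAtEnds {L : ℝ} (u : L2 L) : Prop :=
  ∃ f : ℝ → ℝ, ContinuousOn f (Icc 0 L) ∧ u =ᵐ[volume.restrict (Ioo 0 L)] f ∧ f 0 = 0 ∧ f L = 0

lemma integrable_mul_test {L : ℝ} (u : L2 L) {ψ : ℝ → ℝ} (hc : Continuous ψ)
    (hs : HasCompactSupport ψ) :
    Integrable (fun s => u s * ψ s) (volume.restrict (Ioo (0 : ℝ) L)) :=
  (Lp.memLp u).integrable_mul (hc.memLp_of_hasCompactSupport (p := 2) hs)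

lemma HasWeakDeriv.add {L : ℝ} {u v g k : L2 L} (hu : HasWeakDeriv u g) (hv : HasWeakDeriv v k) :
    HasWeakDeriv (u + v) (g + k) := by
  intro φ h1 h2 h3
  have hd : Continuous (deriv φ) := h1.continuous_deriv (by simp)
  have e1 : ∫ s in Ioo 0 L, (u + v : L2 L) s * deriv φ s
      = ∫ s in Ioo 0 L, (u s * deriv φ s + v s * deriv φ s) := by
    refine integral_congr_ae ?_
    filter_upwards [Lp.coeFn_add u v] with s hs
    rw [hs, Pi.add_apply, add_mul]
  have e2 : ∫ s in Ioo 0 L, (g + k : L2 L) s * φ s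
      = ∫ s in Ioo 0 L, (g s * φ s + k s * φ s) := by
    refine integral_congr_ae ?_
    filter_upwards [Lp.coeFn_add g k] with s hs
    rw [hs, Pi.add_apply, add_mul]
  rw [e1, e2, integral_add (integrable_mul_test u hd h2.deriv) (integrable_mul_test v hd h2.deriv),
    integral_add (integrable_mul_test g h1.continuous h2)
      (integrable_mul_test k h1.continuous h2), hu φ h1 h2 h3, hv φ h1 h2 h3]
  ring

lemma HasWeakDeriv.smul {L : ℝ} {u g : L2 L} (c : ℝ) (hu : HasWeakDeriv u g) :
    HasWeakDeriv (c • u) (c • g) := by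
  intro φ h1 h2 h3
  have e1 : ∫ s in Ioo 0 L, (c • u : L2 L) s * deriv φ s
      = ∫ s in Ioo 0 L, c * (u s * deriv φ s) := by
    refine integral_congr_ae ?_
    filter_upwards [Lp.coeFn_smul c u] with s hs
    rw [hs, Pi.smul_apply, smul_eq_mul, mul_assoc]
  have e2 : ∫ s in Ioo 0 L, (c • g : L2 L) s * φ s = ∫ s in Ioo 0 L, c * (g s * φ s) := by
    refine integral_congr_ae ?_
    filter_upwards [Lp.coeFn_smul c g] with s hs
    rw [hs, Pi.smul_apply, smul_eq_mul, mul_assoc]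
  rw [e1, e2, integral_const_mul, integral_const_mul, hu φ h1 h2 h3]
  ring

lemma VanishesAtEnds.add {L : ℝ} {u v : L2 L} (hu : VanishesAtEnds u) (hv : VanishesAtEnds v) :
    VanishesAtEnds (u + v) := by
  obtain ⟨f, f1, f2, f3, f4⟩ := hu
  obtain ⟨g, g1, g2, g3, g4⟩ := hv
  refine ⟨fun s => f s + g s, f1.add g1, ?_, by simp [f3, g3], by simp [f4, g4]⟩
  filter_upwards [Lp.coeFn_add u v, f2, g2] with s h1 h2 h3
  rw [h1, Pi.add_apply, h2, h3]

lemma VanishesAtEnds.smul {L : ℝ} {u : L2 L} (c : ℝ) (hu : VanishesAtEnds u) :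
    VanishesAtEnds (c • u) := by
  obtain ⟨f, f1, f2, f3, f4⟩ := hu
  refine ⟨fun s => c * f s, continuousOn_const.mul f1, ?_, by simp [f3], by simp [f4]⟩
  filter_upwards [Lp.coeFn_smul c u, f2] with s h1 h2
  rw [h1, Pi.smul_apply, h2, smul_eq_mul]

/-- The space `V = H²₀(0, L)`: functions in `L²(0, L)` with generalized derivatives `u'`, `u''` in
`L²(0, L)` and `u(0) = u'(0) = u(L) = u'(L) = 0`. -/
noncomputable def H20 (L : ℝ) : Submodule ℝ (L2 L) where
  carrier := {u | ∃ u' u'' : L2 L, HasWeakDeriv u u' ∧ HasWeakDeriv u' u'' ∧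
    VanishesAtEnds u ∧ VanishesAtEnds u'}
  add_mem' := by
    rintro u v ⟨u', u'', a1, a2, a3, a4⟩ ⟨v', v'', b1, b2, b3, b4⟩
    exact ⟨u' + v', u'' + v'', a1.add b1, a2.add b2, a3.add b3, a4.add b4⟩
  zero_mem' := by
    have h1 : HasWeakDeriv (0 : L2 L) 0 := by
      intro φ _ _ _
      have e (ψ : ℝ → ℝ) : ∫ s in Ioo 0 L, (0 : L2 L) s * ψ s = 0 := by
        refine integral_eq_zero_of_ae ?_
        filter_upwards [Lp.coeFn_zero ℝ 2 (volume.restrict (Ioo (0 : ℝ) L))] with s hs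
        rw [hs, Pi.zero_apply, zero_mul]
      rw [e, e, neg_zero]
    have h2 : VanishesAtEnds (0 : L2 L) :=
      ⟨0, continuousOn_const, Lp.coeFn_zero ℝ 2 _, rfl, rfl⟩
    exact ⟨0, 0, h1, h1, h2, h2⟩
  smul_mem' := by
    rintro c u ⟨u', u'', a1, a2, a3, a4⟩
    exact ⟨c • u', c • u'', a1.smul c, a2.smul c, a3.smul c, a4.smul c⟩

/-- Weak derivatives are unique. -/
lemma HasWeakDeriv.unique {L : ℝ} {u g k : L2 L} (hg : HasWeakDeriv u g) (hk : HasWeakDeriv u k) :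
    g = k := by
  refine Lp.ext ?_
  have hgi : LocallyIntegrableOn (fun s => g s - k s) (Ioo 0 L) :=
    IntegrableOn.locallyIntegrableOn (((Lp.memLp g).integrable (by norm_num)).sub
      ((Lp.memLp k).integrable (by norm_num)))
  have := isOpen_Ioo.ae_eq_zero_of_integral_contDiff_smul_eq_zero hgi (fun φ h1 h2 h3 => by
    have hA := hg φ h1 h2 h3
    rw [hk φ h1 h2 h3, neg_inj] at hA
    have hz : ∀ s, s ∉ Ioo 0 L → φ s • (g s - k s) = 0 := by
      intro s hs
      rw [image_eq_zero_of_notMem_tsupport (fun h => hs (h3 h)), zero_smul]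
    rw [← setIntegral_eq_integral_of_forall_compl_eq_zero hz]
    have : ∀ s, φ s • (g s - k s) = g s * φ s - k s * φ s := by
      intro s; rw [smul_eq_mul]; ring
    simp_rw [this]
    rw [integral_sub (integrable_mul_test g h1.continuous h2)
      (integrable_mul_test k h1.continuous h2), hA, sub_self])
  refine (ae_restrict_iff' measurableSet_Ioo).2 ?_
  filter_upwards [this] with s hs h
  exact sub_eq_zero.1 (hs h)

open Classical in
/-- The weak derivative `u'` (zero if `u` has none in `L²(0, L)`). -/
noncomputable def weakDeriv {L : ℝ} (u : L2 L) : L2 L :=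
  if h : ∃ g : L2 L, HasWeakDeriv u g then h.choose else 0

lemma HasWeakDeriv.weakDeriv_eq {L : ℝ} {u g : L2 L} (h : HasWeakDeriv u g) :
    weakDeriv u = g := by
  have hex : ∃ g : L2 L, HasWeakDeriv u g := ⟨g, h⟩
  rw [weakDeriv, dif_pos hex]
  exact hex.choose_spec.unique h

/-- The form `∫₀ᴸ κ u'' v'' dx`. -/
noncomputable def bendingForm {L : ℝ} (κ : ℝ → ℝ) (u v : L2 L) : ℝ :=
  ∫ s in Ioo 0 L, κ s * weakDeriv (weakDeriv u) s * weakDeriv (weakDeriv v) s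

/-- The form `b(u, v) = ∫₀ᴸ u' v' dx`. -/
noncomputable def bucklingForm {L : ℝ} (u v : L2 L) : ℝ :=
  ∫ s in Ioo 0 L, weakDeriv u s * weakDeriv v s

/-- The space spanned by all `u ∈ W` with `∫₀ᴸ κ u'' v'' dx = μ ∫₀ᴸ u' v' dx` for all `v ∈ W`, that
is, the eigenspace of the buckling problem on `W` for the value `μ`. -/
noncomputable def eigenspace {L : ℝ} (κ : ℝ → ℝ) (W : Submodule ℝ (L2 L)) (μ : ℝ) : Submodule ℝ (L2 L) :=
  Submodule.span ℝ {u | u ∈ W ∧ ∀ v ∈ W, bendingForm κ u v = μ * bucklingForm u v}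

/-- The family `lam` lists the eigenvalues of the buckling problem with stiffness `κ` on the trial
and test space `W` in nondecreasing order, every real number occurring exactly as often as the
dimension of its eigenspace says (so not at all if it is not an eigenvalue). -/
def ListsEigenvalues {L : ℝ} {ι : Type} [Preorder ι] (κ : ℝ → ℝ) (W : Submodule ℝ (L2 L))
    (lam : ι → ℝ) : Prop :=
  Monotone lam ∧
    ∀ μ : ℝ, {i | lam i = μ}.encard = Cardinal.toENat (Module.rank ℝ (eigenspace κ W μ))

/-- `0 = x 0 < x 1 < ⋯ < x n = L`. -/
structure IsPartition (L : ℝ) {n : ℕ} (x : Fin (n + 1) → ℝ) : Prop where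
  strictMono : StrictMono x
  first : x 0 = 0
  last : x (Fin.last n) = L

/-- The cubic Hermite finite element space: the elements of `H²₀(0, L)` that are polynomials of
degree at most three on each element `[x k, x (k + 1)]`. -/
noncomputable def hermiteSpace (L : ℝ) {N : ℕ} (x : Fin (N + 1) → ℝ) : Submodule ℝ (L2 L) where
  carrier := {v | v ∈ H20 L ∧ ∀ k : Fin N, ∃ p : ℝ[X], p.degree ≤ 3 ∧
    ∀ᵐ s ∂(volume.restrict (Ioo 0 L)), s ∈ Icc (x k.castSucc) (x k.succ) → v s = p.eval s}
  add_mem' := by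
    rintro u v ⟨hu, hu'⟩ ⟨hv, hv'⟩
    refine ⟨(H20 L).add_mem hu hv, fun k => ?_⟩
    obtain ⟨p, p1, p2⟩ := hu' k
    obtain ⟨q, q1, q2⟩ := hv' k
    refine ⟨p + q, (Polynomial.degree_add_le p q).trans (max_le p1 q1), ?_⟩
    filter_upwards [Lp.coeFn_add u v, p2, q2] with s h1 h2 h3 hs
    rw [h1, Pi.add_apply, h2 hs, h3 hs, Polynomial.eval_add]
  zero_mem' := by
    refine ⟨(H20 L).zero_mem, fun k => ⟨0, by simp, ?_⟩⟩
    filter_upwards [Lp.coeFn_zero ℝ 2 (volume.restrict (Ioo (0 : ℝ) L))] with s hs _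
    rw [hs, Pi.zero_apply, Polynomial.eval_zero]
  smul_mem' := by
    rintro c u ⟨hu, hu'⟩
    refine ⟨(H20 L).smul_mem c hu, fun k => ?_⟩
    obtain ⟨p, p1, p2⟩ := hu' k
    refine ⟨c • p, (Polynomial.degree_smul_le c p).trans p1, ?_⟩
    filter_upwards [Lp.coeFn_smul c u, p2] with s h1 h2 hs
    rw [h1, Pi.smul_apply, h2 hs, Polynomial.eval_smul]

/-- The thickness of the beam on the `k`-th element of a mesh on whose open elements `t` is
constant: its value at the midpoint. -/
noncomputable def elementThickness (t : ℝ → ℝ) {N : ℕ} (x : Fin (N + 1) → ℝ) (k : Fin N) : ℝ :=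
  t ((x k.castSucc + x k.succ) / 2)

/-- `Ĉ_h² = (1 / 4π²) max_k h_k² / t_k³`. -/
noncomputable def constSq (t : ℝ → ℝ) {N : ℕ} (x : Fin (N + 1) → ℝ) : ℝ :=
  1 / (4 * Real.pi ^ 2) *
    ⨆ k : Fin N, (x k.succ - x k.castSucc) ^ 2 / elementThickness t x k ^ 3

/-- The bending stiffness `E I(x)` with `I(x) = b t(x)³ / 12` of a beam with rectangular
cross-section of width `b` and thickness `t(x)` and with constant Young's modulus `E`. -/
noncomputable def rectStiffness (E b : ℝ) (t : ℝ → ℝ) (s : ℝ) : ℝ :=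
  E * (b * t s ^ 3 / 12)

end Beam

/-! The weight is absorbed into the unknown. With f = t^{3/2} u'', the bending form becomes the L²
inner product and u' = Bf, where B multiplies by t^{-3/2} and integrates from 0. The conditions at 0
hold automatically. Those at L say that f is orthogonal to t^{-3/2} and s t^{-3/2}
(`mem_H20_iff_reconstruct`). The buckling problem is thus ⟪f, k⟫ = λ⟪Bf, Bk⟫ on the closed subspace
`weightedSpace`. Since t is constant on each element, the Hermite functions correspond to the
piecewise affine f in that space (`mem_hermiteSpace_iff`), and the Galerkin method is the
restriction of B to this subspace W.

The upper bound is the min-max principle. For the lower bound (`eigenvalue_bounds`), take f in the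
span of the first exact eigenvectors, orthogonal to all discrete eigenvectors before the i-th, and
split f = p + q with p in W and q orthogonal to W. The discrete Rayleigh bound controls Bp, and the
projection estimate ‖Bq‖² ≤ Ĉ_h²‖q‖² controls Bq. Young's inequality with the optimal parameter
combines the two.

The projection estimate (`norm_sq_le_of_orthogonal`) is where the constant arises. If f is
orthogonal to W in `weightedSpace`, then it is orthogonal to all piecewise affine functions
(`mem_orthogonal_of_inf`), and so is t^{-3/2} f. Its primitive therefore vanishes at every node and
has mean zero on every element, so `wirtinger` applies with the sharp factor h_k/(2π), obtained from
Fourier series.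

The same estimate on uniform meshes shows that integration is a norm limit of finite-rank operators,
so B is compact (`isCompactOperator_primCLM`). B is also injective, so successive maximization of
‖Bk‖²/‖k‖² yields a list containing every eigenvalue with its multiplicity. -/

namespace Beam

/-! ### Generalized eigenvalue problems for a compact operator on a Hilbert space. -/

section Abstract

open Filter Topology
open scoped InnerProductSpace

variable {H K : Type*} [NormedAddCommGroup H] [InnerProductSpace ℝ H]
  [NormedAddCommGroup K] [InnerProductSpace ℝ K]

/-- The eigenspace of the generalized problem `⟪f, k⟫ = μ ⟪B f, B k⟫` for all `k`. -/
def formEigenspace (B : H →L[ℝ] K) (μ : ℝ) : Submodule ℝ H where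
  carrier := {f | ∀ k, ⟪f, k⟫_ℝ = μ * ⟪B f, B k⟫_ℝ}
  add_mem' := by
    intro f g hf hg k
    rw [map_add, inner_add_left, inner_add_left, hf k, hg k, mul_add]
  zero_mem' := by intro k; simp
  smul_mem' := by
    intro c f hf k
    rw [map_smul, inner_smul_left, inner_smul_left, hf k]
    simp only [conj_trivial]
    ring

/-- `lam` lists the eigenvalues of `⟪f, k⟫ = μ ⟪B f, B k⟫` in nondecreasing order, with
multiplicity. -/
def ListsFormEigenvalues {ι : Type*} [Preorder ι] (B : H →L[ℝ] K) (lam : ι → ℝ) : Prop :=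
  Monotone lam ∧
    ∀ μ : ℝ, {i | lam i = μ}.encard = Cardinal.toENat (Module.rank ℝ (formEigenspace B μ))

lemma pos_of_mem_formEigenspace {B : H →L[ℝ] K} {μ : ℝ} {f : H} (hf : f ∈ formEigenspace B μ)
    (h0 : f ≠ 0) : 0 < μ := by
  have h := hf f
  rw [real_inner_self_eq_norm_sq, real_inner_self_eq_norm_sq] at h
  have h1 : 0 < ‖f‖ ^ 2 := by positivity
  rw [h] at h1
  exact pos_of_mul_pos_left h1 (by positivity)

lemma inner_eq_zero_of_mem_formEigenspace {B : H →L[ℝ] K} {μ ν : ℝ} {f k : H}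
    (hf : f ∈ formEigenspace B μ) (hk : k ∈ formEigenspace B ν) (h : μ ≠ ν) : ⟪f, k⟫_ℝ = 0 := by
  have h1 := hf k
  have h2 := hk f
  rw [real_inner_comm, real_inner_comm (B f) (B k)] at h2
  have h3 : (μ - ν) * ⟪B f, B k⟫_ℝ = 0 := by linarith
  rcases mul_eq_zero.1 h3 with h4 | h4
  · exact absurd (sub_eq_zero.1 h4) h
  · rw [h1, h4, mul_zero]

section Complete

variable [CompleteSpace H] [CompleteSpace K]

lemma mem_formEigenspace_iff {B : H →L[ℝ] K} {μ : ℝ} (hμ : μ ≠ 0) {f : H} :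
    f ∈ formEigenspace B μ ↔ B.adjoint (B f) = μ⁻¹ • f := by
  constructor
  · intro h
    refine ext_inner_right ℝ fun k => ?_
    rw [ContinuousLinearMap.adjoint_inner_left, inner_smul_left, h k]
    simp [hμ]
  · intro h k
    rw [← ContinuousLinearMap.adjoint_inner_left, h, inner_smul_left]
    simp [hμ]

/-- Taking reciprocals turns the generalized problem into the ordinary one for B*B, so that the
spectral theory of compact and of symmetric operators applies. -/
lemma formEigenspace_eq_eigenspace {B : H →L[ℝ] K} {μ : ℝ} (hμ : μ ≠ 0) :
    formEigenspace B μ =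
      Module.End.eigenspace ((B.adjoint ∘L B : H →L[ℝ] H) : H →ₗ[ℝ] H) μ⁻¹ := by
  ext f
  rw [mem_formEigenspace_iff hμ, Module.End.mem_eigenspace_iff]
  rfl

lemma finiteDimensional_formEigenspace {B : H →L[ℝ] K} (hB : IsCompactOperator B) (μ : ℝ) :
    FiniteDimensional ℝ (formEigenspace B μ) := by
  by_cases hμ : μ = 0
  · have : formEigenspace B μ = ⊥ := by
      refine (Submodule.eq_bot_iff _).2 fun f hf => ?_
      have := hf f
      rw [hμ, zero_mul] at this
      exact inner_self_eq_zero.1 this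
    rw [this]
    infer_instance
  · rw [formEigenspace_eq_eigenspace hμ]
    exact ContinuousLinearMap.finite_dimensional_eigenspace (hB.clm_comp B.adjoint) _
      (inv_ne_zero hμ)

/-- A compact operator attains its norm at a singular vector. -/
lemma exists_maximizer [Nontrivial H] {B : H →L[ℝ] K} (hB : IsCompactOperator B) :
    ∃ e : H, ‖e‖ = 1 ∧ ∀ k, ⟪B e, B k⟫_ℝ = ‖B‖ ^ 2 * ⟪e, k⟫_ℝ := by
  set T : H →L[ℝ] H := B.adjoint ∘L B with hT
  have hTi : ∀ f k, ⟪T f, k⟫_ℝ = ⟪B f, B k⟫_ℝ := fun f k => by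
    rw [hT, ContinuousLinearMap.comp_apply, ContinuousLinearMap.adjoint_inner_left]
  have hTn : ‖T‖ = ‖B‖ ^ 2 := by
    rw [hT, ContinuousLinearMap.norm_adjoint_comp_self, sq]
  have hTs : IsSelfAdjoint T := by
    rw [ContinuousLinearMap.isSelfAdjoint_iff_isSymmetric]
    intro f k
    change ⟪T f, k⟫_ℝ = ⟪f, T k⟫_ℝ
    rw [hTi, real_inner_comm, ← hTi, real_inner_comm]
  have hTc : IsCompactOperator T := hB.clm_comp B.adjoint
  suffices h : ∃ f : H, f ≠ 0 ∧ T f = ‖T‖ • f by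
    obtain ⟨f, f0, hf⟩ := h
    refine ⟨‖f‖⁻¹ • f, by simp [norm_smul, f0], fun k => ?_⟩
    rw [← hTi, map_smul, hf, hTn, smul_comm, inner_smul_left]
    simp
  by_cases h0 : T = 0
  · obtain ⟨f, hf⟩ := exists_ne (0 : H)
    exact ⟨f, hf, by simp [h0]⟩
  -- For self-adjoint T the spectral radius is the norm, so some spectral value c has |c| = ‖T‖.
  -- Compactness makes c ≠ 0 an eigenvalue, and positivity of B*B excludes c = -‖T‖.
  have hr : spectralRadius ℝ T = ‖T‖₊ := T.spectralRadius_eq_nnnorm hTs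
  have hne : (spectrum ℝ T).Nonempty := by
    by_contra hcon
    rw [Set.not_nonempty_iff_eq_empty] at hcon
    have : spectralRadius ℝ T = 0 := by simp [spectralRadius, hcon]
    rw [this] at hr
    have : ‖T‖₊ = 0 := by exact_mod_cast hr.symm
    exact h0 (nnnorm_eq_zero.1 this)
  obtain ⟨c, hc, hcr⟩ := spectrum.exists_nnnorm_eq_spectralRadius_of_nonempty hne
  have hcn : ‖c‖ = ‖T‖ := by
    rw [hr] at hcr
    have : ‖c‖₊ = ‖T‖₊ := by exact_mod_cast hcr
    exact congrArg NNReal.toReal this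
  have hc0 : c ≠ 0 := by
    intro h
    rw [h, norm_zero] at hcn
    exact h0 (norm_eq_zero.1 hcn.symm)
  obtain ⟨f, hf⟩ := ((hTc.hasEigenvalue_iff_mem_spectrum hc0).2 hc).exists_hasEigenvector
  have hfe : T f = c • f := hf.apply_eq_smul
  refine ⟨f, hf.2, ?_⟩
  have hcp : 0 ≤ c := by
    have h1 : ⟪T f, f⟫_ℝ = ‖B f‖ ^ 2 := by rw [hTi, real_inner_self_eq_norm_sq]
    rw [hfe, inner_smul_left, real_inner_self_eq_norm_sq] at h1
    have h2 : 0 < ‖f‖ ^ 2 := by have := norm_pos_iff.2 hf.2; positivity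
    simp only [conj_trivial] at h1
    by_contra hneg
    nlinarith [sq_nonneg ‖B f‖]
  rw [hfe, ← hcn, Real.norm_of_nonneg hcp]

/-- The Rayleigh quotient attains its maximum over the orthogonal complement of an invariant
finite-dimensional subspace, at an eigenvector. -/
lemma exists_maximizer_orthogonal {B : H →L[ℝ] K} (hB : IsCompactOperator B) (F : Submodule ℝ H)
    [FiniteDimensional ℝ F] (hF : ∀ f ∈ F, ∀ g ∈ Fᗮ, ⟪B f, B g⟫_ℝ = 0) (hF' : Fᗮ ≠ ⊥) :
    ∃ (e : H) (ν : ℝ), e ∈ Fᗮ ∧ ‖e‖ = 1 ∧ (∀ k, ⟪B e, B k⟫_ℝ = ν * ⟪e, k⟫_ℝ) ∧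
      ∀ k ∈ Fᗮ, ‖B k‖ ^ 2 ≤ ν * ‖k‖ ^ 2 := by
  have : Nontrivial Fᗮ := Submodule.nontrivial_iff_ne_bot.2 hF'
  set B' : Fᗮ →L[ℝ] K := B ∘L Fᗮ.subtypeL with hB'
  obtain ⟨e, e1, e2⟩ := exists_maximizer (B := B') (hB.comp_clm Fᗮ.subtypeL)
  refine ⟨e, ‖B'‖ ^ 2, e.2, by simpa using e1, fun k => ?_, fun k hk => ?_⟩
  -- The eigenvector equation known on Fᗮ extends to the whole space, because the component of k in
  -- F contributes zero to both sides.
  · obtain ⟨p, hp, q, hq, rfl⟩ := F.exists_add_mem_mem_orthogonal k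
    have h1 : ⟪B e, B q⟫_ℝ = ‖B'‖ ^ 2 * ⟪(e : H), q⟫_ℝ := e2 ⟨q, hq⟩
    rw [map_add, inner_add_right, inner_add_right, h1, real_inner_comm, hF p hp e e.2,
      (Submodule.mem_orthogonal' F e).1 e.2 p hp, zero_add, zero_add]
  · have h := B'.le_opNorm ⟨k, hk⟩
    have h' : ‖B k‖ ≤ ‖B'‖ * ‖k‖ := h
    calc ‖B k‖ ^ 2 ≤ (‖B'‖ * ‖k‖) ^ 2 := by gcongr
      _ = _ := by ring

end Complete

end Abstract

/-! ### Rayleigh quotients and two-sided Galerkin bounds. -/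

section Lists

open Filter Topology
open scoped InnerProductSpace

variable {H K : Type*} [NormedAddCommGroup H] [InnerProductSpace ℝ H]
  [NormedAddCommGroup K] [InnerProductSpace ℝ K]

/-- A linear map into a space of dimension `m` kills a nontrivial combination of `m + 1` vectors. -/
lemma exists_combination_eq_zero {E : Type*} [AddCommGroup E] [Module ℝ E] {m : ℕ}
    (e : Fin (m + 1) → E) (φ : E →ₗ[ℝ] (Fin m → ℝ)) :
    ∃ c : Fin (m + 1) → ℝ, c ≠ 0 ∧ φ (∑ k, c k • e k) = 0 := by
  have h : LinearMap.ker (φ ∘ₗ Fintype.linearCombination ℝ e) ≠ ⊥ := by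
    apply LinearMap.ker_ne_bot_of_finrank_lt
    simp
  obtain ⟨c, hc, hc0⟩ := Submodule.exists_mem_ne_zero_of_ne_bot h
  refine ⟨c, hc0, ?_⟩
  simpa [Fintype.linearCombination_apply] using hc

/-- Upper bound for the Rayleigh quotient on a span of eigenvectors. -/
lemma rayleigh_upper {κ : Type*} [Fintype κ] {B : H →L[ℝ] K} {lam : κ → ℝ} {e : κ → H}
    (he : Orthonormal ℝ e) (he' : ∀ i, e i ∈ formEigenspace B (lam i)) {Λ : ℝ}
    (hΛ : ∀ i, lam i ≤ Λ) (c : κ → ℝ) :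
    ‖∑ i, c i • e i‖ ^ 2 ≤ Λ * ‖B (∑ i, c i • e i)‖ ^ 2 := by
  classical
  have hpos : ∀ i, 0 < lam i := fun i => pos_of_mem_formEigenspace (he' i) (he.ne_zero i)
  -- The eigenvectors diagonalize both forms at once, so the inequality can be checked term by term.
  have hBe : ∀ i j, ⟪B (e i), B (e j)⟫_ℝ = if i = j then (lam i)⁻¹ else 0 := by
    intro i j
    have h1 := he' i (e j)
    rw [orthonormal_iff_ite.1 he i j] at h1
    split_ifs with hij
    · rw [if_pos hij] at h1
      exact eq_inv_of_mul_eq_one_right h1.symm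
    · rw [if_neg hij] at h1
      exact (mul_eq_zero.1 h1.symm).resolve_left (hpos i).ne'
  have h1 : ‖∑ i, c i • e i‖ ^ 2 = ∑ i, c i ^ 2 := by
    rw [← real_inner_self_eq_norm_sq, he.inner_sum]
    simp [sq]
  have h2 : ‖B (∑ i, c i • e i)‖ ^ 2 = ∑ i, c i ^ 2 * (lam i)⁻¹ := by
    rw [← real_inner_self_eq_norm_sq, map_sum, sum_inner]
    refine Finset.sum_congr rfl fun i _ => ?_
    rw [inner_sum]
    simp only [map_smul, inner_smul_left, inner_smul_right, hBe]
    simp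
    ring
  rw [h1, h2, Finset.mul_sum]
  refine Finset.sum_le_sum fun i _ => ?_
  have h3 : 1 ≤ Λ * (lam i)⁻¹ := by
    rw [← div_eq_mul_inv, le_div_iff₀ (hpos i), one_mul]
    exact hΛ i
  nlinarith [sq_nonneg (c i)]

/-- The restriction of a bounded operator to a subspace. -/
noncomputable def restrictOp (B : H →L[ℝ] K) (W : Submodule ℝ H) : W →L[ℝ] K := B ∘L W.subtypeL

lemma restrictOp_apply (B : H →L[ℝ] K) (W : Submodule ℝ H) (f : W) :
    restrictOp B W f = B f := rfl

lemma injective_restrictOp {B : H →L[ℝ] K} (hB : Function.Injective B) (W : Submodule ℝ H) :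
    Function.Injective (restrictOp B W) := hB.comp Subtype.val_injective

lemma isCompactOperator_restrictOp {B : H →L[ℝ] K} (hB : IsCompactOperator B)
    (W : Submodule ℝ H) : IsCompactOperator (restrictOp B W) := hB.comp_clm W.subtypeL

section Complete

variable [CompleteSpace H] [CompleteSpace K]

/-- A list of the eigenvalues comes with an orthonormal family of eigenvectors spanning the
eigenspaces. -/
lemma ListsFormEigenvalues.exists_eigenvectors {ι : Type*} [Preorder ι] {B : H →L[ℝ] K}
    (hB : IsCompactOperator B) {lam : ι → ℝ} (h : ListsFormEigenvalues B lam) :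
    ∃ e : ι → H, Orthonormal ℝ e ∧ (∀ i, e i ∈ formEigenspace B (lam i)) ∧
      ∀ μ, formEigenspace B μ ≤ Submodule.span ℝ (e '' {i | lam i = μ}) := by
  have hfd := finiteDimensional_formEigenspace hB
  have henc : ∀ μ : ℝ, {i | lam i = μ}.encard = Module.finrank ℝ (formEigenspace B μ) := by
    intro μ
    rw [h.2 μ, ← Module.finrank_eq_rank, map_natCast]
  let _ : ∀ μ : ℝ, Fintype {i | lam i = μ} := fun μ => (Set.finite_of_encard_eq_coe (henc μ)).fintype
  have hcard : ∀ μ : ℝ, Fintype.card {i | lam i = μ} = Module.finrank ℝ (formEigenspace B μ) := by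
    intro μ
    have h1 := Set.encard_eq_coe_toFinset_card {i | lam i = μ}
    rw [henc μ, Set.toFinset_card] at h1
    exact_mod_cast h1.symm
  -- The occurrences of μ in the list are as many as the (finite) dimension of its eigenspace, so
  -- they can index an orthonormal basis of it.
  let b : ∀ μ : ℝ, OrthonormalBasis {i | lam i = μ} ℝ (formEigenspace B μ) := fun μ =>
    (stdOrthonormalBasis ℝ (formEigenspace B μ)).reindex (Fintype.equivFinOfCardEq (hcard μ)).symm
  have key : ∀ i μ (hi : lam i = μ), (b (lam i) ⟨i, rfl⟩ : H) = b μ ⟨i, hi⟩ := by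
    rintro i _ rfl; rfl
  refine ⟨fun i => b (lam i) ⟨i, rfl⟩, ?_, fun i => (b (lam i) ⟨i, rfl⟩).2, fun μ => ?_⟩
  · constructor
    · intro i
      exact (b (lam i)).orthonormal.1 _
    · intro i j hij
      by_cases hl : lam i = lam j
      · change ⟪(b (lam i) ⟨i, rfl⟩ : H), (b (lam j) ⟨j, rfl⟩ : H)⟫_ℝ = 0
        rw [key i _ hl]
        exact (b (lam j)).orthonormal.2 (fun hc => hij (by simpa using hc))
      · exact inner_eq_zero_of_mem_formEigenspace (b (lam i) ⟨i, rfl⟩).2 (b (lam j) ⟨j, rfl⟩).2 hl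
  · intro f hf
    have h1 := (b μ).sum_repr ⟨f, hf⟩
    have h2 : f ∈ Submodule.span ℝ (Set.range fun i => (b μ i : H)) := by
      have h3 : (⟨f, hf⟩ : formEigenspace B μ) ∈ Submodule.span ℝ (Set.range (b μ)) := by
        rw [← (b μ).coe_toBasis, (b μ).toBasis.span_eq]
        trivial
      have h4 := Submodule.mem_map_of_mem (f := (formEigenspace B μ).subtype) h3
      rw [Submodule.map_span, ← Set.range_comp] at h4
      exact h4
    refine Submodule.span_mono ?_ h2
    rintro _ ⟨⟨i, hi⟩, rfl⟩
    exact ⟨i, hi, key i μ hi⟩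

lemma ListsFormEigenvalues.pos {ι : Type*} [Preorder ι] {B : H →L[ℝ] K}
    (hB : IsCompactOperator B) {lam : ι → ℝ} (h : ListsFormEigenvalues B lam) (i : ι) :
    0 < lam i := by
  obtain ⟨e, e1, e2, -⟩ := h.exists_eigenvectors hB
  exact pos_of_mem_formEigenspace (e2 i) (e1.ne_zero i)

/-- Lower bound for the Rayleigh quotient on the complement of the first eigenvectors. -/
lemma rayleigh_lower {ι : Type*} [LinearOrder ι] [LocallyFiniteOrderBot ι] {B : H →L[ℝ] K}
    (hB : IsCompactOperator B) (hinj : Function.Injective B) {lam : ι → ℝ} (hmono : Monotone lam)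
    {e : ι → H} (he : Orthonormal ℝ e) (he' : ∀ i, e i ∈ formEigenspace B (lam i))
    (hspan : ∀ μ, formEigenspace B μ ≤ Submodule.span ℝ (e '' {i | lam i = μ}))
    (i : ι) {f : H} (hf : ∀ j < i, ⟪e j, f⟫_ℝ = 0) : lam i * ‖B f‖ ^ 2 ≤ ‖f‖ ^ 2 := by
  by_cases hf0 : f = 0
  · simp [hf0]
  set F : Submodule ℝ H := Submodule.span ℝ (e '' Iio i) with hF
  have hfin : (e '' Iio i).Finite := (Set.finite_Iio i).image e
  have : FiniteDimensional ℝ F := FiniteDimensional.span_of_finite ℝ hfin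
  have hmem : f ∈ Fᗮ := by
    rw [Submodule.mem_orthogonal]
    intro u hu
    induction hu using Submodule.span_induction with
    | mem x hx => obtain ⟨j, hj, rfl⟩ := hx; exact hf j hj
    | zero => simp
    | add x y _ _ hx hy => rw [inner_add_left, hx, hy, add_zero]
    | smul c x _ hx => rw [inner_smul_left, hx, mul_zero]
  have hbot : Fᗮ ≠ ⊥ := fun h => hf0 (by rw [h] at hmem; exact hmem)
  have hinv : ∀ u ∈ F, ∀ g ∈ Fᗮ, ⟪B u, B g⟫_ℝ = 0 := by
    intro u hu g hg
    induction hu using Submodule.span_induction with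
    | mem x hx =>
      obtain ⟨j, hj, rfl⟩ := hx
      have h1 := he' j g
      rw [(Submodule.mem_orthogonal F g).1 hg _ (Submodule.subset_span ⟨j, hj, rfl⟩)] at h1
      exact (mul_eq_zero.1 h1.symm).resolve_left
        (pos_of_mem_formEigenspace (he' j) (he.ne_zero j)).ne'
    | zero => simp
    | add x y _ _ hx hy => rw [map_add, inner_add_left, hx, hy, add_zero]
    | smul c x _ hx => rw [map_smul, inner_smul_left, hx, mul_zero]
  obtain ⟨w, ν, hw, hw1, hw2, hw3⟩ := exists_maximizer_orthogonal hB F hinv hbot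
  have hBf : 0 < ‖B f‖ ^ 2 := by
    have : B f ≠ 0 := fun h => hf0 (hinj (by rw [h, map_zero]))
    positivity
  have hν : 0 < ν := pos_of_mul_pos_left (hBf.trans_le (hw3 f hmem)) (by positivity)
  have hwe : w ∈ formEigenspace B ν⁻¹ := by
    intro k
    rw [hw2 k, inv_mul_cancel_left₀ hν.ne']
  -- Were ν⁻¹ smaller, its eigenspace would be spanned by listed vectors with index below i. Then
  -- the unit vector w would lie both in F and in Fᗮ.
  have hle : lam i ≤ ν⁻¹ := by
    by_contra! hlt
    have hwF : w ∈ F := by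
      refine Submodule.span_mono (Set.image_mono ?_) (hspan _ hwe)
      intro j hj
      by_contra hji
      have := hmono (not_lt.1 hji)
      rw [show lam j = ν⁻¹ from hj] at this
      exact absurd this (not_le.2 hlt)
    have := (Submodule.mem_orthogonal F w).1 hw w hwF
    rw [real_inner_self_eq_norm_sq, hw1] at this
    norm_num at this
  calc lam i * ‖B f‖ ^ 2 ≤ ν⁻¹ * (ν * ‖f‖ ^ 2) := by
        gcongr
        exact hw3 f hmem
    _ = ‖f‖ ^ 2 := inv_mul_cancel_left₀ hν.ne' _

/-- Two-sided eigenvalue bounds for the Galerkin approximation on a subspace `W`, in terms of the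
constant in the error estimate for the orthogonal projection onto `W`. -/
theorem eigenvalue_bounds {B : H →L[ℝ] K} (hB : IsCompactOperator B)
    (hinj : Function.Injective B) (W : Submodule ℝ H) [FiniteDimensional ℝ W] {C : ℝ} (hC : 0 ≤ C)
    (hW : ∀ f ∈ Wᗮ, ‖B f‖ ^ 2 ≤ C * ‖f‖ ^ 2) {n : ℕ} {lam : ℕ → ℝ} {lamh : Fin n → ℝ}
    (h : ListsFormEigenvalues B lam) (hh : ListsFormEigenvalues (restrictOp B W) lamh)
    (i : Fin n) : lamh i / (1 + lamh i * C) ≤ lam i ∧ lam i ≤ lamh i := by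
  have hBW := isCompactOperator_restrictOp hB W
  have hinjW := injective_restrictOp hinj W
  obtain ⟨e, e1, e2, e3⟩ := h.exists_eigenvectors hB
  obtain ⟨d, d1, d2, d3⟩ := hh.exists_eigenvectors hBW
  have hlam := h.pos hB i
  have hlamh := hh.pos hBW i
  constructor
  · let emb : Fin (i + 1) → ℕ := fun k => k
    have hemb : Function.Injective emb := Fin.val_injective
    let low : Fin i → Fin n := fun k => ⟨k, k.2.trans i.2⟩
    -- Indices start at 0: the exact eigenvectors 0, …, i are i + 1 vectors, subject to i conditions
    -- of orthogonality to the discrete eigenvectors before the i-th.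
    obtain ⟨c, c0, hc⟩ := exists_combination_eq_zero (e ∘ emb)
      (LinearMap.pi fun k => (innerₛₗ ℝ (d (low k) : H)) )
    set f := ∑ k, c k • (e ∘ emb) k with hf
    have hf0 : f ≠ 0 := by
      intro h0
      refine c0 (funext fun k => ?_)
      exact Fintype.linearIndependent_iff.1 (e1.comp emb hemb).linearIndependent c h0 k
    have hup : ‖f‖ ^ 2 ≤ lam i * ‖B f‖ ^ 2 :=
      rayleigh_upper (e1.comp emb hemb) (lam := lam ∘ emb) (fun k => e2 _)
        (fun k => h.1 (Nat.lt_succ_iff.1 k.2)) c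
    obtain ⟨p, hp, q, hq, hpq⟩ := W.exists_add_mem_mem_orthogonal f
    -- The orthogonality of f passes to its projection p, since the discrete eigenvectors lie in W
    -- and q is orthogonal to W.
    have hlow : lamh i * ‖B p‖ ^ 2 ≤ ‖p‖ ^ 2 := by
      refine rayleigh_lower (f := (⟨p, hp⟩ : W)) hBW hinjW hh.1 d1 d2 d3 i fun j hj => ?_
      have h1 := congrFun hc ⟨j, hj⟩
      have h2 : ⟪(d j : H), f⟫_ℝ = 0 := h1
      rw [hpq, inner_add_right, (Submodule.mem_orthogonal W q).1 hq _ (d j).2, add_zero] at h2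
      exact h2
    have hq' := hW q hq
    have hpyth : ‖f‖ ^ 2 = ‖p‖ ^ 2 + ‖q‖ ^ 2 := by
      rw [hpq, sq, sq, sq]
      exact norm_add_sq_eq_norm_sq_add_norm_sq_of_inner_eq_zero _ _
        ((Submodule.mem_orthogonal W q).1 hq p hp)
    have hBf : ‖B f‖ ≤ ‖B p‖ + ‖B q‖ := by
      rw [hpq, map_add]
      exact norm_add_le _ _
    have hf2 : 0 < ‖f‖ ^ 2 := by positivity
    have hsum : lamh i * ‖B f‖ ^ 2 ≤ (1 + lamh i * C) * ‖f‖ ^ 2 := by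
      have hsq : ‖B f‖ ^ 2 ≤ (‖B p‖ + ‖B q‖) ^ 2 := by gcongr
      have ha : lamh i * (‖B p‖ + ‖B q‖) ^ 2 ≤ (1 + lamh i * C) * (‖p‖ ^ 2 + ‖q‖ ^ 2) := by
        have hD : (0 : ℝ) ≤ lamh i * C := by positivity
        rcases hC.eq_or_lt with hC0 | hC0
        · have : ‖B q‖ = 0 := by
            rw [← hC0, zero_mul] at hq'
            nlinarith [norm_nonneg (B q)]
          rw [this, add_zero, ← hC0, mul_zero, add_zero, one_mul]
          nlinarith [sq_nonneg ‖q‖]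
        · have hx : ‖B q‖ ^ 2 / C ≤ ‖q‖ ^ 2 := by
            rw [div_le_iff₀ hC0]; linarith
          -- Young's inequality (a + b)² ≤ (1 + ε)a² + (1 + 1/ε)b² with ε = `lamh i * C`; the
          -- deficit is a perfect square. The division by C is why C = 0 is treated separately.
          have key : lamh i * (‖B p‖ + ‖B q‖) ^ 2 ≤
              (1 + lamh i * C) * (lamh i * ‖B p‖ ^ 2 + ‖B q‖ ^ 2 / C) := by
            have : (1 + lamh i * C) * (lamh i * ‖B p‖ ^ 2 + ‖B q‖ ^ 2 / C)
                - lamh i * (‖B p‖ + ‖B q‖) ^ 2 = (lamh i * C * ‖B p‖ - ‖B q‖) ^ 2 / C := by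
              field_simp
              ring
            have h5 : 0 ≤ (lamh i * C * ‖B p‖ - ‖B q‖) ^ 2 / C := by positivity
            linarith
          refine key.trans ?_
          gcongr
      rw [hpyth]
      exact (mul_le_mul_of_nonneg_left hsq hlamh.le).trans ha
    rw [div_le_iff₀ (by positivity)]
    have h6 : lamh i * ‖f‖ ^ 2 ≤ lam i * ((1 + lamh i * C) * ‖f‖ ^ 2) :=
      calc lamh i * ‖f‖ ^ 2 ≤ lamh i * (lam i * ‖B f‖ ^ 2) := by gcongr
        _ = lam i * (lamh i * ‖B f‖ ^ 2) := by ring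
        _ ≤ _ := by gcongr
    rw [← mul_assoc] at h6
    exact le_of_mul_le_mul_right h6 hf2
  · let emb : Fin (i + 1) → Fin n := fun k => ⟨k, lt_of_lt_of_le k.2 i.2⟩
    have hemb : Function.Injective emb := fun a b hab => Fin.ext (by simpa [emb] using hab)
    -- The roles are exchanged: a combination of discrete eigenvectors is made orthogonal to the
    -- first exact ones. It lies in the full space already, so no projection error occurs.
    obtain ⟨c, c0, hc⟩ := exists_combination_eq_zero (d ∘ emb)
      (LinearMap.pi fun k : Fin i => (innerₛₗ ℝ (e k)) ∘ₗ W.subtype)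
    set f := ∑ k, c k • (d ∘ emb) k with hf
    have hf0 : f ≠ 0 := by
      intro h0
      refine c0 (funext fun k => ?_)
      exact Fintype.linearIndependent_iff.1 (d1.comp emb hemb).linearIndependent c h0 k
    have hup : ‖f‖ ^ 2 ≤ lamh i * ‖B f‖ ^ 2 :=
      rayleigh_upper (B := restrictOp B W) (d1.comp emb hemb) (lam := lamh ∘ emb) (fun k => d2 _)
        (fun k => hh.1 (Nat.lt_succ_iff.1 k.2)) c
    have hlow : lam i * ‖B f‖ ^ 2 ≤ ‖(f : H)‖ ^ 2 :=
      rayleigh_lower hB hinj h.1 e1 e2 e3 i fun j hj => congrFun hc ⟨j, hj⟩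
    have hBf : 0 < ‖B f‖ ^ 2 := by
      have : B f ≠ 0 := fun h => hf0 (Subtype.ext (hinj (by rw [h]; simp)))
      positivity
    exact le_of_mul_le_mul_right (hlow.trans hup) hBf

end Complete

end Lists

/-! ### Existence of the eigenvalue lists. -/

section Existence

open Filter Topology
open scoped InnerProductSpace

variable {H K : Type*} [NormedAddCommGroup H] [InnerProductSpace ℝ H]
  [NormedAddCommGroup K] [InnerProductSpace ℝ K]

/-- An orthonormal family of eigenvectors that spans every eigenspace lists the eigenvalues. -/
lemma ListsFormEigenvalues.of_eigenvectors {ι : Type} [Preorder ι] {B : H →L[ℝ] K} {lam : ι → ℝ}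
    (hmono : Monotone lam) {e : ι → H} (he : Orthonormal ℝ e)
    (he' : ∀ i, e i ∈ formEigenspace B (lam i))
    (hspan : ∀ μ, formEigenspace B μ ≤ Submodule.span ℝ (e '' {i | lam i = μ})) :
    ListsFormEigenvalues B lam := by
  refine ⟨hmono, fun μ => ?_⟩
  have h1 : formEigenspace B μ = Submodule.span ℝ (e '' {i | lam i = μ}) := by
    refine le_antisymm (hspan μ) (Submodule.span_le.2 ?_)
    rintro _ ⟨i, rfl, rfl⟩
    exact he' i
  have hli := he.linearIndependent
  have h2 : LinearIndepOn ℝ id (e '' {i | lam i = μ}) := (hli.linearIndepOn _).id_image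
  rw [h1, rank_span_set h2, ← hli.injective.encard_image]
  rfl

/-- A compact operator is not bounded below on an orthonormal sequence of singular vectors. -/
lemma exists_singular_value_lt {B : H →L[ℝ] K} (hB : IsCompactOperator B) {e : ℕ → H}
    {ν : ℕ → ℝ} (he : Orthonormal ℝ e)
    (h : ∀ n k, ⟪B (e n), B k⟫_ℝ = ν n * ⟪e n, k⟫_ℝ) {c : ℝ} (hc : 0 < c) : ∃ n, ν n < c := by
  by_contra! hcon
  have hcpt := hB.isCompact_closure_image_closedBall (f := (B : H →ₗ[ℝ] K)) 1
  obtain ⟨g, -, φ, hφ, hlim⟩ := hcpt.tendsto_subseq (x := fun n => B (e n)) fun n =>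
    subset_closure ⟨e n, by simp [he.1 n], rfl⟩
  have hcau := hlim.cauchySeq
  rw [Metric.cauchySeq_iff'] at hcau
  obtain ⟨N, hN⟩ := hcau (Real.sqrt c) (Real.sqrt_pos.2 hc)
  have h1 := hN (N + 1) N.le_succ
  have hne : φ (N + 1) ≠ φ N := (hφ N.lt_succ_self).ne'
  -- The images are orthogonal as well, so if every ν n were at least c their mutual squared
  -- distances would be at least 2c, and no subsequence could be Cauchy.
  have h2 : ‖B (e (φ (N + 1))) - B (e (φ N))‖ ^ 2 = ν (φ (N + 1)) + ν (φ N) := by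
    rw [norm_sub_sq_real, ← real_inner_self_eq_norm_sq, ← real_inner_self_eq_norm_sq, h, h, h,
      real_inner_self_eq_norm_sq, real_inner_self_eq_norm_sq, he.1, he.1, he.2 hne]
    ring
  rw [Function.comp_apply, Function.comp_apply, dist_eq_norm, Real.lt_sqrt (norm_nonneg _), h2]
    at h1
  linarith [hcon (φ (N + 1)), hcon (φ N)]

section Complete

variable [CompleteSpace H] [CompleteSpace K]

/-- Existence of the list of eigenvalues in finite dimension. -/
theorem exists_listsFormEigenvalues_fin [FiniteDimensional ℝ H] {B : H →L[ℝ] K}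
    (hinj : Function.Injective B) {n : ℕ} (hn : Module.finrank ℝ H = n) :
    ∃ lam : Fin n → ℝ, ListsFormEigenvalues B lam := by
  set T : H →ₗ[ℝ] H := ((B.adjoint ∘L B : H →L[ℝ] H) : H →ₗ[ℝ] H) with hT
  have hTi : ∀ f k, ⟪T f, k⟫_ℝ = ⟪B f, B k⟫_ℝ := fun f k =>
    ContinuousLinearMap.adjoint_inner_left B k (B f)
  have hTs : T.IsSymmetric := by
    intro f k
    rw [hTi, real_inner_comm, ← hTi, real_inner_comm]
  have hpos : ∀ i, 0 < hTs.eigenvalues hn i := by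
    intro i
    have hv := hTs.hasEigenvector_eigenvectorBasis hn i
    set v := hTs.eigenvectorBasis hn i
    have hBv : B v ≠ 0 := fun h => hv.2 (hinj (by rw [h, map_zero]))
    have h1 := hTi v v
    rw [hv.apply_eq_smul, inner_smul_left, real_inner_self_eq_norm_sq,
      real_inner_self_eq_norm_sq] at h1
    have h2 : 0 < ‖B v‖ ^ 2 := by positivity
    rw [← h1] at h2
    exact pos_of_mul_pos_left h2 (by positivity)
  refine ⟨fun i => (hTs.eigenvalues hn i)⁻¹, fun i j hij => ?_, fun μ => ?_⟩
  · exact inv_anti₀ (hpos j) (hTs.eigenvalues_antitone hn hij)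
  · by_cases hμ : μ = 0
    · have h1 : formEigenspace B μ = ⊥ := by
        refine (Submodule.eq_bot_iff _).2 fun f hf => ?_
        by_contra h0
        exact (pos_of_mem_formEigenspace hf h0).ne' hμ
      have h2 : {i | (hTs.eigenvalues hn i)⁻¹ = μ} = ∅ := by
        refine Set.eq_empty_of_forall_notMem fun i hi => ?_
        exact (inv_pos.2 (hpos i)).ne' (hi.trans hμ)
      rw [h1, h2]
      simp
    · have h1 := hTs.card_filter_eigenvalues_eq hn μ⁻¹
      rw [formEigenspace_eq_eigenspace hμ, ← Module.finrank_eq_rank, map_natCast, ← h1,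
        ← Set.encard_coe_eq_coe_finsetCard]
      congr 1
      ext i
      simp only [mem_ofPred_eq, Finset.coe_filter, Finset.mem_univ, true_and]
      exact ⟨fun h => by rw [← h, inv_inv]; rfl, fun h => by
        have h' : hTs.eigenvalues hn i = μ⁻¹ := h
        rw [h', inv_inv]⟩

/-- Eigenvectors of a compact operator, chosen one after another by maximization of the Rayleigh
quotient. -/
lemma exists_eigenvector_sequence (hdim : ¬ FiniteDimensional ℝ H) {B : H →L[ℝ] K}
    (hB : IsCompactOperator B) :
    ∃ (e : ℕ → H) (ν : ℕ → ℝ), Orthonormal ℝ e ∧ Antitone ν ∧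
      (∀ n k, ⟪B (e n), B k⟫_ℝ = ν n * ⟪e n, k⟫_ℝ) ∧
      ∀ n k, (∀ j < n, ⟪e j, k⟫_ℝ = 0) → ‖B k‖ ^ 2 ≤ ν n * ‖k‖ ^ 2 := by
  have hstep : ∀ F : {F : Submodule ℝ H // FiniteDimensional ℝ F ∧
      ∀ f ∈ F, ∀ g ∈ Fᗮ, ⟪B f, B g⟫_ℝ = 0}, ∃ p : H × ℝ, p.1 ∈ F.1ᗮ ∧ ‖p.1‖ = 1 ∧
        (∀ k, ⟪B p.1, B k⟫_ℝ = p.2 * ⟪p.1, k⟫_ℝ) ∧ ∀ k ∈ F.1ᗮ, ‖B k‖ ^ 2 ≤ p.2 * ‖k‖ ^ 2 := by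
    rintro ⟨F, hF, hF'⟩
    have hbot : Fᗮ ≠ ⊥ := by
      intro h
      rw [Submodule.orthogonal_eq_bot_iff] at h
      rw [h] at hF
      exact hdim (Module.Finite.equiv (Submodule.topEquiv (R := ℝ) (M := H)))
    obtain ⟨e, ν, h⟩ := exists_maximizer_orthogonal hB F hF' hbot
    exact ⟨(e, ν), h⟩
  choose p p1 p2 p3 p4 using hstep
  -- The recursion carries finite dimension and invariance along with the subspace, since both are
  -- needed to find the next maximizer.
  let next : {F : Submodule ℝ H // FiniteDimensional ℝ F ∧
      ∀ f ∈ F, ∀ g ∈ Fᗮ, ⟪B f, B g⟫_ℝ = 0} → {F : Submodule ℝ H // FiniteDimensional ℝ F ∧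
      ∀ f ∈ F, ∀ g ∈ Fᗮ, ⟪B f, B g⟫_ℝ = 0} := fun F =>
    ⟨F.1 ⊔ Submodule.span ℝ {(p F).1}, by
      have := F.2.1
      infer_instance, by
      intro f hf g hg
      obtain ⟨a, ha, b, hb, rfl⟩ := Submodule.mem_sup.1 hf
      obtain ⟨c, rfl⟩ := Submodule.mem_span_singleton.1 hb
      rw [← Submodule.inf_orthogonal] at hg
      rw [map_add, inner_add_left, F.2.2 a ha g hg.1, map_smul, inner_smul_left, p3,
        (Submodule.mem_orthogonal _ g).1 hg.2 _ (Submodule.mem_span_singleton_self _)]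
      simp⟩
  let F : ℕ → {F : Submodule ℝ H // FiniteDimensional ℝ F ∧
      ∀ f ∈ F, ∀ g ∈ Fᗮ, ⟪B f, B g⟫_ℝ = 0} := fun n =>
    Nat.rec ⟨⊥, inferInstance, by intro f hf g _; rw [(Submodule.mem_bot ℝ).1 hf]; simp⟩
      (fun _ => next) n
  have hF : ∀ n, (F (n + 1)).1 = (F n).1 ⊔ Submodule.span ℝ {(p (F n)).1} := fun n => rfl
  have hmono : Monotone fun n => (F n).1 := monotone_nat_of_le_succ fun n => by
    rw [hF]; exact le_sup_left
  have hmem : ∀ m n, m < n → (p (F m)).1 ∈ (F n).1 := fun m n h =>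
    hmono (Nat.succ_le_of_lt h)
      (Submodule.mem_sup_right (Submodule.mem_span_singleton_self _))
  have horth : ∀ m n, m < n → ⟪(p (F m)).1, (p (F n)).1⟫_ℝ = 0 := fun m n h =>
    (Submodule.mem_orthogonal _ _).1 (p1 (F n)) _ (hmem m n h)
  have hcompl : ∀ n k, (∀ j < n, ⟪(p (F j)).1, k⟫_ℝ = 0) → k ∈ (F n).1ᗮ := by
    intro n k hk
    induction n with
    | zero =>
      change k ∈ (⊥ : Submodule ℝ H)ᗮ
      simp
    | succ n ih =>
      rw [hF, ← Submodule.inf_orthogonal]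
      refine ⟨ih fun j hj => hk j (hj.trans n.lt_succ_self), ?_⟩
      exact Submodule.mem_orthogonal_singleton_iff_inner_right.2 (hk n n.lt_succ_self)
  refine ⟨fun n => (p (F n)).1, fun n => (p (F n)).2, ⟨fun n => p2 _, fun m n h => ?_⟩,
    antitone_nat_of_succ_le fun n => ?_, fun n => p3 _, fun n k hk => p4 _ k (hcompl n k hk)⟩
  · rcases lt_or_gt_of_ne h with h | h
    · exact horth m n h
    · rw [real_inner_comm]; exact horth n m h
  · have h1 := p4 (F n) (p (F (n + 1))).1
      (Submodule.orthogonal_le (hmono n.le_succ) (p1 (F (n + 1))))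
    have h2 := p3 (F (n + 1)) (p (F (n + 1))).1
    rw [real_inner_self_eq_norm_sq, real_inner_self_eq_norm_sq] at h2
    rw [h2] at h1
    simpa [p2] using h1

/-- Existence of the list of eigenvalues in infinite dimension. -/
theorem exists_listsFormEigenvalues_nat (hdim : ¬ FiniteDimensional ℝ H) {B : H →L[ℝ] K}
    (hB : IsCompactOperator B) (hinj : Function.Injective B) :
    ∃ lam : ℕ → ℝ, ListsFormEigenvalues B lam := by
  obtain ⟨e, ν, he, hν, h1, h2⟩ := exists_eigenvector_sequence hdim hB
  have hsmall := fun c hc => exists_singular_value_lt hB he h1 (c := c) hc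
  have hpos : ∀ n, 0 < ν n := by
    intro n
    have hBv : B (e n) ≠ 0 := fun h => he.ne_zero n (hinj (by rw [h, map_zero]))
    have h3 := h1 n (e n)
    rw [real_inner_self_eq_norm_sq, real_inner_self_eq_norm_sq, he.1 n] at h3
    have : 0 < ‖B (e n)‖ ^ 2 := by positivity
    linarith
  have he' : ∀ n, e n ∈ formEigenspace B (ν n)⁻¹ := fun n k => by
    rw [h1, inv_mul_cancel_left₀ (hpos n).ne']
  refine ⟨fun n => (ν n)⁻¹, .of_eigenvectors (fun m n hmn => inv_anti₀ (hpos n) (hν hmn)) he he' ?_⟩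
  intro μ f hf
  by_cases hf0 : f = 0
  · rw [hf0]; exact Submodule.zero_mem _
  have hμ := pos_of_mem_formEigenspace hf hf0
  -- The values ν n decrease to 0, so each is repeated only finitely often; the span below is then
  -- finite-dimensional and admits a projection.
  have hfin : {n | (ν n)⁻¹ = μ}.Finite := by
    obtain ⟨N, hN⟩ := hsmall μ⁻¹ (inv_pos.2 hμ)
    refine (Set.finite_Iio N).subset fun n hn => ?_
    by_contra hnN
    have h3 := hν (not_lt.1 hnN)
    have h4 : ν n = μ⁻¹ := by rw [← show (ν n)⁻¹ = μ from hn, inv_inv]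
    linarith
  have : FiniteDimensional ℝ (Submodule.span ℝ (e '' {n | (ν n)⁻¹ = μ})) :=
    FiniteDimensional.span_of_finite ℝ (hfin.image e)
  obtain ⟨p, hp, q, hq, rfl⟩ :=
    (Submodule.span ℝ (e '' {n | (ν n)⁻¹ = μ})).exists_add_mem_mem_orthogonal f
  have hpE : p ∈ formEigenspace B μ := by
    refine Submodule.span_le.2 ?_ hp
    rintro _ ⟨i, rfl, rfl⟩
    exact he' i
  have hqE : q ∈ formEigenspace B μ := by
    have := Submodule.sub_mem _ hf hpE
    rwa [add_sub_cancel_left] at this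
  have hqe : ∀ n, ⟪e n, q⟫_ℝ = 0 := by
    intro n
    by_cases hn : (ν n)⁻¹ = μ
    · exact (Submodule.mem_orthogonal _ q).1 hq _ (Submodule.subset_span ⟨n, hn, rfl⟩)
    · exact inner_eq_zero_of_mem_formEigenspace (he' n) hqE hn
  -- As q is orthogonal to every e n, ‖B q‖² ≤ ν N ‖q‖² for all N. Since ν N tends to 0, B q = 0,
  -- and injectivity finishes.
  have hq0 : q = 0 := by
    by_contra hq0
    have hBq : B q ≠ 0 := fun h => hq0 (hinj (by rw [h, map_zero]))
    have h5 : 0 < ‖B q‖ ^ 2 := by positivity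
    have h6 : 0 < ‖q‖ ^ 2 := by positivity
    obtain ⟨N, hN⟩ := hsmall (‖B q‖ ^ 2 / ‖q‖ ^ 2) (by positivity)
    have h7 := h2 N q fun j _ => hqe j
    rw [lt_div_iff₀ h6] at hN
    linarith
  rw [hq0, add_zero]
  exact hp

end Complete

end Existence

/-! ### Primitives in L²(0, L) and the description of H²₀ through them. -/

section Primitive

open Filter Topology
open scoped ENNReal

variable {L : ℝ}

/-- The extension of `u ∈ L²(0, L)` by zero. -/
noncomputable def extend (u : L2 L) : ℝ → ℝ := (Ioo (0 : ℝ) L).indicator u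

/-- The primitive `x ↦ ∫₀ˣ u`. -/
noncomputable def prim (u : L2 L) (x : ℝ) : ℝ := ∫ s in (0 : ℝ)..x, extend u s

lemma extend_apply (u : L2 L) {s : ℝ} (hs : s ∈ Ioo 0 L) : extend u s = u s :=
  indicator_of_mem hs _

lemma memLp_extend (u : L2 L) : MemLp (extend u) 2 volume :=
  (memLp_indicator_iff_restrict measurableSet_Ioo).2 (Lp.memLp u)

lemma integrable_extend (u : L2 L) : Integrable (extend u) volume :=
  (integrable_indicator_iff measurableSet_Ioo).2 ((Lp.memLp u).integrable (by norm_num))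

lemma intervalIntegrable_extend (u : L2 L) (a b : ℝ) : IntervalIntegrable (extend u) volume a b :=
  (integrable_extend u).intervalIntegrable

lemma extend_add (u v : L2 L) : extend (u + v) =ᵐ[volume] fun s => extend u s + extend v s := by
  filter_upwards [(ae_restrict_iff' measurableSet_Ioo).1 (Lp.coeFn_add u v)] with s hs
  by_cases h1 : s ∈ Ioo 0 L
  · rw [extend_apply _ h1, extend_apply _ h1, extend_apply _ h1, hs h1, Pi.add_apply]
  · simp [extend, indicator_of_notMem h1]

lemma extend_smul (c : ℝ) (u : L2 L) : extend (c • u) =ᵐ[volume] fun s => c * extend u s := by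
  filter_upwards [(ae_restrict_iff' measurableSet_Ioo).1 (Lp.coeFn_smul c u)] with s hs
  by_cases h1 : s ∈ Ioo 0 L
  · rw [extend_apply _ h1, extend_apply _ h1, hs h1, Pi.smul_apply, smul_eq_mul]
  · simp [extend, indicator_of_notMem h1]

lemma continuous_prim (u : L2 L) : Continuous (prim u) :=
  intervalIntegral.continuous_primitive (fun a b => intervalIntegrable_extend u a b) 0

lemma prim_zero (u : L2 L) : prim u 0 = 0 := intervalIntegral.integral_same

lemma prim_sub_prim (u : L2 L) (a b : ℝ) : prim u b - prim u a = ∫ s in a..b, extend u s :=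
  intervalIntegral.integral_interval_sub_left (intervalIntegrable_extend u _ _)
    (intervalIntegrable_extend u _ _)

lemma prim_add (u v : L2 L) (x : ℝ) : prim (u + v) x = prim u x + prim v x := by
  rw [prim, prim, prim, ← intervalIntegral.integral_add (intervalIntegrable_extend u _ _)
    (intervalIntegrable_extend v _ _)]
  exact intervalIntegral.integral_congr_ae ((extend_add u v).mono fun s hs _ => hs)

lemma prim_smul (c : ℝ) (u : L2 L) (x : ℝ) : prim (c • u) x = c * prim u x := by
  rw [prim, prim, ← intervalIntegral.integral_const_mul]
  exact intervalIntegral.integral_congr_ae ((extend_smul c u).mono fun s hs _ => hs)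

lemma ae_hasDerivAt_prim (u : L2 L) : ∀ᵐ x, HasDerivAt (prim u) (extend u x) x := by
  filter_upwards [LocallyIntegrable.ae_hasDerivAt_integral (integrable_extend u).locallyIntegrable] with x hx
  exact hx 0

lemma absolutelyContinuous_prim (u : L2 L) (a b : ℝ) :
    AbsolutelyContinuousOnInterval (prim u) a b :=
  ((intervalIntegrable_extend u (min (min a b) 0) (max (max a b) 0)
    ).absolutelyContinuousOnInterval_intervalIntegral (c := 0) (by simp)).mono
    (uIcc_subset_uIcc (by simp) (by simp))

/-- Integration by parts for the primitive. -/
lemma integral_prim_mul (u : L2 L) {φ φ' : ℝ → ℝ} (hφ : ∀ s, HasDerivAt φ (φ' s) s)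
    (hc : Continuous φ') (a b : ℝ) :
    ∫ s in a..b, prim u s * φ' s =
      prim u b * φ b - prim u a * φ a - ∫ s in a..b, extend u s * φ s := by
  have hd : deriv φ = φ' := funext fun s => (hφ s).deriv
  have hC : ContDiff ℝ 1 φ := contDiff_one_iff_deriv.2
    ⟨fun s => (hφ s).differentiableAt, by rw [hd]; exact hc⟩
  have h := (absolutelyContinuous_prim u a b).integral_mul_deriv_eq_deriv_mul
    (hC.contDiffOn.absolutelyContinuousOnInterval (a := a) (b := b))
  rw [hd] at h
  rw [h]
  congr 1
  refine intervalIntegral.integral_congr_ae ?_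
  filter_upwards [ae_hasDerivAt_prim u] with s hs _
  rw [hs.deriv]

lemma integral_Ioo_eq (hL : 0 ≤ L) (f : ℝ → ℝ) :
    ∫ s in Ioo 0 L, f s = ∫ s in (0 : ℝ)..L, f s := by
  rw [intervalIntegral.integral_of_le hL, integral_Ioc_eq_integral_Ioo]

lemma memLp_of_continuous {φ : ℝ → ℝ} (hφ : Continuous φ) :
    MemLp φ 2 (volume.restrict (Ioo (0 : ℝ) L)) := by
  obtain ⟨C, hC⟩ := isCompact_Icc.exists_bound_of_continuousOn (s := Icc 0 L) hφ.continuousOn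
  refine MemLp.of_bound hφ.aestronglyMeasurable C ?_
  filter_upwards [ae_restrict_mem measurableSet_Ioo] with s hs using hC s (Ioo_subset_Icc_self hs)

lemma memLp_prim (u : L2 L) : MemLp (prim u) 2 (volume.restrict (Ioo (0 : ℝ) L)) :=
  memLp_of_continuous (continuous_prim u)

lemma abs_prim_le (u : L2 L) (x : ℝ) :
    |prim u x| ≤ (volume.restrict (Ioo (0 : ℝ) L)).real univ ^ (1 / 2 : ℝ) * ‖u‖ := by
  have h1 : |prim u x| ≤ ∫ s in Ioo 0 L, ‖u s‖ := by
    calc |prim u x| ≤ ∫ s in uIoc 0 x, ‖extend u s‖ := by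
          rw [prim, ← Real.norm_eq_abs]
          exact intervalIntegral.norm_integral_le_integral_norm_uIoc
      _ ≤ ∫ s, ‖extend u s‖ :=
          setIntegral_le_integral (integrable_extend u).norm (ae_of_all _ fun s => norm_nonneg _)
      _ = ∫ s in Ioo 0 L, ‖u s‖ := by
          rw [← integral_indicator measurableSet_Ioo]
          congr 1
          ext s
          rw [extend, norm_indicator_eq_indicator_norm]
  refine h1.trans ?_
  have h2 := eLpNorm_le_eLpNorm_mul_rpow_measure_univ (p := 1) (q := 2) (by norm_num)
    (Lp.memLp u).1
  rw [integral_norm_eq_lintegral_enorm (Lp.memLp u).1, ← eLpNorm_one_eq_lintegral_enorm,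
    Lp.norm_def]
  have h3 := ENNReal.toReal_mono (by
    refine ENNReal.mul_ne_top (Lp.eLpNorm_ne_top u) ?_
    exact ENNReal.rpow_ne_top_of_nonneg (by norm_num) (measure_ne_top _ _)) h2
  rw [ENNReal.toReal_mul, ← ENNReal.toReal_rpow] at h3
  refine h3.trans (le_of_eq ?_)
  rw [mul_comm]
  norm_num [Measure.real]

/-- The primitive as a bounded operator on `L²(0, L)`. -/
noncomputable def primCLM (L : ℝ) : L2 L →L[ℝ] L2 L :=
  LinearMap.mkContinuous
    { toFun := fun u => (memLp_prim u).toLp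
      map_add' := fun u v => by
        rw [← MemLp.toLp_add]
        exact MemLp.toLp_congr _ _ (ae_of_all _ fun s => prim_add u v s)
      map_smul' := fun c u => by
        rw [RingHom.id_apply, ← MemLp.toLp_const_smul]
        exact MemLp.toLp_congr _ _ (ae_of_all _ fun s => prim_smul c u s) }
    (measureUnivNNReal (volume.restrict (Ioo (0 : ℝ) L)) ^ (2 : ℝ≥0∞).toReal⁻¹ *
      (volume.restrict (Ioo (0 : ℝ) L)).real univ ^ (1 / 2 : ℝ)) fun u => by
        rw [mul_assoc]
        refine Lp.norm_le_of_ae_bound (by positivity) ?_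
        filter_upwards [(memLp_prim u).coeFn_toLp] with s hs
        change ‖(memLp_prim u).toLp (prim u) s‖ ≤ _
        rw [hs]
        exact abs_prim_le u s

lemma coeFn_primCLM (u : L2 L) : primCLM L u =ᵐ[volume.restrict (Ioo 0 L)] prim u :=
  (memLp_prim u).coeFn_toLp

/-- `u` is the weak derivative of its primitive. -/
lemma hasWeakDeriv_primCLM (u : L2 L) : HasWeakDeriv (primCLM L u) u := by
  intro φ h1 h2 h3
  rcases le_or_gt L 0 with hL | hL
  · simp [Ioo_eq_empty (not_lt.2 hL)]
  have e1 : ∫ s in Ioo 0 L, primCLM L u s * deriv φ s = ∫ s in Ioo 0 L, prim u s * deriv φ s := by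
    refine integral_congr_ae ?_
    filter_upwards [coeFn_primCLM u] with s hs
    rw [hs]
  have e2 : ∫ s in Ioo 0 L, u s * φ s = ∫ s in Ioo 0 L, extend u s * φ s :=
    setIntegral_congr_fun measurableSet_Ioo fun s hs => by
      simp only [extend_apply u hs]
  have hφ : ∀ s, s ∉ Ioo 0 L → φ s = 0 := fun s hs =>
    image_eq_zero_of_notMem_tsupport fun h => hs (h3 h)
  rw [e1, e2, integral_Ioo_eq hL.le, integral_Ioo_eq hL.le,
    integral_prim_mul u (φ := φ) (φ' := deriv φ)
      (fun s => (h1.differentiable (by simp) s).hasDerivAt) (h1.continuous_deriv (by simp)),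
    hφ L (by simp), hφ 0 (by simp)]
  ring

lemma injective_primCLM : Function.Injective (primCLM L) := by
  refine (injective_iff_map_eq_zero _).2 fun u hu => ?_
  have h := hasWeakDeriv_primCLM u
  rw [hu] at h
  exact h.unique (by simpa using HasWeakDeriv.smul 0 h)

/-- Every test function differs from a multiple of a fixed one by the derivative of a test
function. -/
lemma exists_test_primitive {θ : ℝ → ℝ} (h1 : ContDiff ℝ ∞ θ) (h2 : HasCompactSupport θ)
    (h3 : tsupport θ ⊆ Ioo 0 L) (h4 : ∫ s, θ s = 0) :
    ∃ φ : ℝ → ℝ, ContDiff ℝ ∞ φ ∧ HasCompactSupport φ ∧ tsupport φ ⊆ Ioo 0 L ∧ deriv φ = θ := by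
  have hd : ∀ x, HasDerivAt (fun x => ∫ s in (0 : ℝ)..x, θ s) (θ x) x := fun x =>
    intervalIntegral.integral_hasDerivAt_right (h1.continuous.intervalIntegrable _ _)
      h1.continuous.aestronglyMeasurable.stronglyMeasurableAtFilter h1.continuous.continuousAt
  have hd' : deriv (fun x => ∫ s in (0 : ℝ)..x, θ s) = θ := funext fun x => (hd x).deriv
  obtain ⟨a, b, ha, hb, hab⟩ : ∃ a b, 0 < a ∧ b < L ∧ tsupport θ ⊆ Icc a b := by
    rcases (tsupport θ).eq_empty_or_nonempty with h | h
    · exact ⟨1, L - 1, by norm_num, by linarith, by rw [h]; exact empty_subset _⟩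
    · obtain ⟨a, ha, ha'⟩ := h2.exists_isLeast h
      obtain ⟨b, hb, hb'⟩ := h2.exists_isGreatest h
      exact ⟨a, b, (h3 ha).1, (h3 hb).2, fun s hs => ⟨ha' hs, hb' hs⟩⟩
  have hz : ∀ s, s ∉ Icc a b → θ s = 0 := fun s hs =>
    image_eq_zero_of_notMem_tsupport fun h => hs (hab h)
  have hsupp : Function.support (fun x => ∫ s in (0 : ℝ)..x, θ s) ⊆ Icc a b := by
    intro x hx
    by_contra hcon
    refine hx ?_
    rw [mem_Icc, not_and_or, not_le, not_le] at hcon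
    change ∫ s in (0 : ℝ)..x, θ s = 0
    -- To the left of the support nothing has been collected yet; to the right of it the whole
    -- integral has, and it is zero.
    rcases hcon with h | h
    · refine intervalIntegral.integral_zero_ae (ae_of_all _ fun s hs => hz s fun hs' => ?_)
      rcases mem_uIoc.1 hs with hs | hs <;> linarith [hs'.1, hs.2]
    · by_cases hx0 : 0 ≤ x
      · rw [intervalIntegral.integral_of_le hx0, setIntegral_eq_integral_of_forall_compl_eq_zero, h4]
        intro s hs
        refine hz s fun hs' => hs ⟨ha.trans_le hs'.1, hs'.2.trans h.le⟩
      · refine intervalIntegral.integral_zero_ae (ae_of_all _ fun s hs => hz s fun hs' => ?_)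
        rcases mem_uIoc.1 hs with hs | hs <;> linarith [hs'.1, hs.2, not_le.1 hx0]
  have hts : tsupport (fun x => ∫ s in (0 : ℝ)..x, θ s) ⊆ Icc a b :=
    closure_minimal hsupp isClosed_Icc
  refine ⟨_, contDiff_infty_iff_deriv.2 ⟨fun x => (hd x).differentiableAt, by rw [hd']; exact h1⟩,
    HasCompactSupport.of_support_subset_isCompact isCompact_Icc hsupp,
    hts.trans fun s hs => ⟨ha.trans_le hs.1, hs.2.trans_lt hb⟩, hd'⟩

/-- A function whose weak derivative vanishes is constant. -/
lemma HasWeakDeriv.ae_eq_const (hL : 0 < L) {w : L2 L} (hw : HasWeakDeriv w 0) :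
    ∃ c : ℝ, ∀ᵐ s ∂volume.restrict (Ioo 0 L), w s = c := by
  let bump : ContDiffBump (L / 2) := ⟨L / 8, L / 4, by positivity, by linarith⟩
  set η : ℝ → ℝ := bump.normed volume with hη
  have hη1 : ContDiff ℝ ∞ η := bump.contDiff_normed
  have hη2 : HasCompactSupport η := bump.hasCompactSupport_normed
  have hη3 : tsupport η ⊆ Ioo 0 L := by
    rw [hη, bump.tsupport_normed_eq, Real.closedBall_eq_Icc]
    intro s hs
    have h1 : L / 2 - L / 4 ≤ s := hs.1
    have h2 : s ≤ L / 2 + L / 4 := hs.2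
    exact ⟨by linarith, by linarith⟩
  have hη4 : ∫ s, η s = 1 := bump.integral_normed
  set c := ∫ s in Ioo 0 L, w s * η s with hc
  refine ⟨c, (ae_restrict_iff' measurableSet_Ioo).2 ?_⟩
  have hgi : LocallyIntegrableOn (fun s => w s - c) (Ioo 0 L) :=
    IntegrableOn.locallyIntegrableOn (((Lp.memLp w).integrable (by norm_num)).sub
      (integrable_const c))
  -- The du Bois-Reymond argument: subtracting m η makes the integral of ψ vanish, so ψ - m η is the
  -- derivative of a test function and is annihilated by w. Hence w pairs with ψ as the constant c
  -- does.
  have := isOpen_Ioo.ae_eq_zero_of_integral_contDiff_smul_eq_zero hgi fun ψ h1 h2 h3 => by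
    have hzψ : ∀ s, s ∉ Ioo 0 L → ψ s = 0 := fun s hs =>
      image_eq_zero_of_notMem_tsupport fun h => hs (h3 h)
    set m := ∫ s, ψ s with hm
    obtain ⟨φ, f1, f2, f3, f4⟩ := exists_test_primitive (L := L) (θ := fun s => ψ s - m * η s)
      (h1.sub (contDiff_const.mul hη1)) (h2.sub hη2.mul_left)
      ((tsupport_sub _ _).trans (union_subset h3 ((tsupport_mul_subset_right).trans hη3))) (by
        rw [integral_sub (h1.continuous.integrable_of_hasCompactSupport h2)
          ((hη1.continuous.integrable_of_hasCompactSupport hη2).const_mul m),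
          integral_const_mul, hη4, mul_one, ← hm, sub_self])
    have h5 := hw φ f1 f2 f3
    have h6 : ∫ s in Ioo 0 L, (0 : L2 L) s * φ s = 0 := by
      refine integral_eq_zero_of_ae ?_
      filter_upwards [Lp.coeFn_zero ℝ 2 (volume.restrict (Ioo (0 : ℝ) L))] with s hs
      rw [hs, Pi.zero_apply, zero_mul]
    rw [h6, neg_zero, f4] at h5
    have h7 : ∀ s, w s * (ψ s - m * η s) = w s * ψ s - m * (w s * η s) := fun s => by ring
    simp_rw [h7] at h5
    rw [integral_sub (integrable_mul_test w h1.continuous h2)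
      ((integrable_mul_test w hη1.continuous hη2).const_mul m), integral_const_mul, ← hc] at h5
    have hψi : ∫ s in Ioo 0 L, ψ s = m := setIntegral_eq_integral_of_forall_compl_eq_zero hzψ
    rw [← setIntegral_eq_integral_of_forall_compl_eq_zero (s := Ioo 0 L)
      (fun s hs => by rw [hzψ s hs, zero_smul])]
    have h8 : ∀ s, ψ s • (w s - c) = w s * ψ s - c * ψ s := fun s => by rw [smul_eq_mul]; ring
    simp_rw [h8]
    rw [integral_sub (integrable_mul_test w h1.continuous h2)
      ((h1.continuous.integrable_of_hasCompactSupport h2).integrableOn.const_mul c),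
      integral_const_mul, hψi]
    linarith
  filter_upwards [this] with s hs h
  exact sub_eq_zero.1 (hs h)

/-- A function with a weak derivative that vanishes at both ends is the primitive of its
derivative. -/
lemma HasWeakDeriv.eq_primCLM (hL : 0 < L) {u g : L2 L} (hu : HasWeakDeriv u g)
    (h0 : VanishesAtEnds u) : u = primCLM L g ∧ prim g L = 0 := by
  obtain ⟨f, f1, f2, f3, f4⟩ := h0
  have hw : HasWeakDeriv (u + (-1 : ℝ) • primCLM L g) 0 := by
    have := hu.add ((hasWeakDeriv_primCLM g).smul (-1))
    simpa using this
  obtain ⟨c, hc⟩ := hw.ae_eq_const hL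
  have h1 : f =ᵐ[volume.restrict (Icc 0 L)] fun s => prim g s + c := by
    rw [← restrict_Ioo_eq_restrict_Icc]
    filter_upwards [hc, f2, coeFn_primCLM g, Lp.coeFn_add u ((-1 : ℝ) • primCLM L g),
      Lp.coeFn_smul (-1 : ℝ) (primCLM L g)] with s h1 h2 h3 h4 h5
    rw [h4, Pi.add_apply, h5, Pi.smul_apply, h2, h3, smul_eq_mul] at h1
    linarith
  -- Continuous functions that agree almost everywhere agree up to the end points, so the boundary
  -- values of f determine c and the value of the primitive at L.
  have h2 := Measure.eqOn_Icc_of_ae_eq volume hL.ne h1 f1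
    ((continuous_prim g).add continuous_const).continuousOn
  have h3 := h2 (left_mem_Icc.2 hL.le)
  have h4 := h2 (right_mem_Icc.2 hL.le)
  simp only [prim_zero, f3, f4] at h3 h4
  have hc0 : c = 0 := by linarith
  refine ⟨Lp.ext ?_, by linarith⟩
  rw [← restrict_Ioo_eq_restrict_Icc] at h1
  filter_upwards [f2, h1, coeFn_primCLM g] with s h5 h6 h7
  rw [h5, h6, h7, hc0, add_zero]

lemma vanishesAtEnds_primCLM {g : L2 L} (hg : prim g L = 0) : VanishesAtEnds (primCLM L g) :=
  ⟨prim g, (continuous_prim g).continuousOn, coeFn_primCLM g, prim_zero g, hg⟩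

/-- `H²₀(0, L)` consists of the twofold primitives of the functions with vanishing moments. -/
lemma mem_H20_iff (hL : 0 < L) {u : L2 L} :
    u ∈ H20 L ↔ ∃ g : L2 L, prim g L = 0 ∧ prim (primCLM L g) L = 0 ∧
      u = primCLM L (primCLM L g) := by
  constructor
  · rintro ⟨u', u'', h1, h2, h3, h4⟩
    obtain ⟨h5, h6⟩ := h1.eq_primCLM hL h3
    obtain ⟨h7, h8⟩ := h2.eq_primCLM hL h4
    exact ⟨u'', h8, h7 ▸ h6, h7 ▸ h5⟩
  · rintro ⟨g, h1, h2, rfl⟩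
    exact ⟨_, _, hasWeakDeriv_primCLM _, hasWeakDeriv_primCLM _, vanishesAtEnds_primCLM h2,
      vanishesAtEnds_primCLM h1⟩

lemma weakDeriv_primCLM (g : L2 L) : weakDeriv (primCLM L g) = g :=
  (hasWeakDeriv_primCLM g).weakDeriv_eq

end Primitive

/-! ### Wirtinger's inequality by Fourier series. -/

section Wirtinger

open Filter Topology

variable {L : ℝ}

/-- Integration by parts against a complex-valued function, for a primitive vanishing at both
ends of the interval. -/
lemma integral_prim_mul_complex (u : L2 L) {E E' : ℝ → ℂ} (hE : ∀ s, HasDerivAt E (E' s) s)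
    (hc : Continuous E') {a b : ℝ} (ha : prim u a = 0) (hb : prim u b = 0) :
    ∫ s in a..b, E' s * (prim u s : ℂ) = -∫ s in a..b, E s * (extend u s : ℂ) := by
  have hEc : Continuous E := continuous_iff_continuousAt.2 fun s => (hE s).continuousAt
  have i1 : IntervalIntegrable (fun s => E' s * (prim u s : ℂ)) volume a b :=
    (hc.mul (Complex.continuous_ofReal.comp (continuous_prim u))).intervalIntegrable _ _
  have i2 : IntervalIntegrable (fun s => E s * (extend u s : ℂ)) volume a b :=
    (IntervalIntegrable.continuousOn_mul ⟨(intervalIntegrable_extend u a b).1.ofReal, (intervalIntegrable_extend u a b).2.ofReal⟩ hEc.continuousOn)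
  apply Complex.ext
  · have h := integral_prim_mul u (φ := fun s => (E s).re) (φ' := fun s => (E' s).re)
      (fun s => (Complex.reCLM.hasFDerivAt.comp_hasDerivAt s (hE s)))
      (Complex.continuous_re.comp hc) a b
    have e1 := Complex.reCLM.intervalIntegral_comp_comm i1
    have e2 := Complex.reCLM.intervalIntegral_comp_comm i2
    simp only [Complex.reCLM_apply, Complex.mul_re, Complex.ofReal_re, Complex.ofReal_im, mul_zero,
      sub_zero] at e1 e2
    rw [Complex.neg_re, ← e1, ← e2]
    simp only [ha, hb, zero_mul, sub_zero, zero_sub] at h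
    simpa only [mul_comm] using h
  · have h := integral_prim_mul u (φ := fun s => (E s).im) (φ' := fun s => (E' s).im)
      (fun s => (Complex.imCLM.hasFDerivAt.comp_hasDerivAt s (hE s)))
      (Complex.continuous_im.comp hc) a b
    have e1 := Complex.imCLM.intervalIntegral_comp_comm i1
    have e2 := Complex.imCLM.intervalIntegral_comp_comm i2
    simp only [Complex.imCLM_apply, Complex.mul_im, Complex.ofReal_re, Complex.ofReal_im, mul_zero,
      zero_add] at e1 e2
    rw [Complex.neg_im, ← e1, ← e2]
    simp only [ha, hb, zero_mul, sub_zero, zero_sub] at h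
    simpa only [mul_comm] using h

/-- Integration by parts against the exponential; the boundary terms drop out because the primitive
vanishes at a and b. -/
lemma fourierCoeffOn_extend (u : L2 L) {a b : ℝ} (hab : a < b) (ha : prim u a = 0)
    (hb : prim u b = 0) (n : ℤ) :
    fourierCoeffOn hab (fun s => (extend u s : ℂ)) n =
      (2 * Real.pi * Complex.I * n / (b - a)) * fourierCoeffOn hab (fun s => (prim u s : ℂ)) n := by
  have h := integral_prim_mul_complex u (fun s => hasDerivAt_fourier_neg (b - a) n s)
    (by
      refine continuous_const.mul ?_
      exact (map_continuous (fourier (-n))).comp (AddCircle.continuous_mk' _)) ha hb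
  simp only [mul_assoc (_ / _ : ℂ)] at h
  rw [intervalIntegral.integral_const_mul, eq_neg_iff_add_eq_zero, add_comm,
    ← eq_neg_iff_add_eq_zero] at h
  rw [fourierCoeffOn_eq_integral, fourierCoeffOn_eq_integral]
  simp only [smul_eq_mul]
  rw [h, mul_smul_comm]
  congr 1
  push_cast
  ring

/-- Wirtinger's inequality with the optimal constant. -/
lemma wirtinger (u : L2 L) {a b : ℝ} (hab : a < b) (ha : prim u a = 0) (hb : prim u b = 0)
    (hm : ∫ s in a..b, prim u s = 0) :
    ∫ s in a..b, prim u s ^ 2 ≤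
      ((b - a) / (2 * Real.pi)) ^ 2 * ∫ s in a..b, extend u s ^ 2 := by
  have hba : 0 < b - a := sub_pos.2 hab
  have hpi := Real.pi_pos
  have m1 : MemLp (fun s => (prim u s : ℂ)) 2 (volume.restrict (Ioc a b)) := by
    obtain ⟨C, hC⟩ := isCompact_Icc.exists_bound_of_continuousOn (s := Icc a b)
      (continuous_prim u).continuousOn
    refine MemLp.ofReal (MemLp.of_bound (continuous_prim u).aestronglyMeasurable C ?_)
    filter_upwards [ae_restrict_mem measurableSet_Ioc] with s hs using hC s (Ioc_subset_Icc_self hs)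
  have m2 : MemLp (fun s => (extend u s : ℂ)) 2 (volume.restrict (Ioc a b)) :=
    MemLp.ofReal ((memLp_extend u).restrict _)
  have s1 := hasSum_sq_fourierCoeffOn hab m1
  have s2 := (hasSum_sq_fourierCoeffOn hab m2).mul_left (((b - a) / (2 * Real.pi)) ^ 2)
  -- Parseval on both sides reduces the claim to single coefficients. The zeroth one of the
  -- primitive is its mean, which is zero; for n ≠ 0 the ratio is |n| ≥ 1 after scaling.
  have hle := hasSum_le (fun n => ?_) s1 s2
  · simp only [Complex.norm_real, Real.norm_eq_abs, sq_abs, smul_eq_mul] at hle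
    rw [mul_left_comm] at hle
    exact le_of_mul_le_mul_left hle (inv_pos.2 hba)
  · by_cases hn : n = 0
    · have : fourierCoeffOn hab (fun s => (prim u s : ℂ)) n = 0 := by
        rw [fourierCoeffOn_eq_integral, hn]
        simp only [neg_zero, fourier_zero, one_smul]
        rw [intervalIntegral.integral_ofReal, hm]
        simp
      rw [this, norm_zero, zero_pow two_ne_zero]
      positivity
    · have hn1 : (1 : ℝ) ≤ |(n : ℝ)| := by exact_mod_cast Int.one_le_abs hn
      rw [fourierCoeffOn_extend u hab ha hb n, norm_mul, mul_pow, ← mul_assoc]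
      refine le_mul_of_one_le_left (by positivity) ?_
      have : ‖(2 * Real.pi * Complex.I * n / (b - a) : ℂ)‖ = 2 * Real.pi * |(n : ℝ)| / (b - a) := by
        rw [← Complex.ofReal_sub, norm_div, norm_mul, norm_mul, norm_mul, Complex.norm_I,
          Complex.norm_real, Complex.norm_real, Complex.norm_intCast, Real.norm_of_nonneg hpi.le,
          Real.norm_of_nonneg hba.le]
        norm_num
      rw [this, ← mul_pow]
      refine one_le_pow₀ ?_
      rw [show (b - a) / (2 * Real.pi) * (2 * Real.pi * |(n : ℝ)| / (b - a)) = |(n : ℝ)| by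
        field_simp]
      exact hn1

end Wirtinger

/-! ### Piecewise affine functions, the elementwise error estimate and compactness. -/

section Elements

open Filter Topology
open scoped InnerProductSpace ENNReal

variable {L : ℝ} {N : ℕ} {x : Fin (N + 1) → ℝ}

/-- The open element `(x k, x (k + 1))`. -/
def elem (x : Fin (N + 1) → ℝ) (k : Fin N) : Set ℝ := Ioo (x k.castSucc) (x k.succ)

lemma measurableSet_elem (k : Fin N) : MeasurableSet (elem x k) := measurableSet_Ioo

lemma IsPartition.lt (hx : IsPartition L x) (k : Fin N) : x k.castSucc < x k.succ :=
  hx.strictMono Fin.castSucc_lt_succ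

lemma IsPartition.nonneg (hx : IsPartition L x) (i : Fin (N + 1)) : 0 ≤ x i := by
  rw [← hx.first]; exact hx.strictMono.monotone (Fin.zero_le i)

lemma IsPartition.le (hx : IsPartition L x) (i : Fin (N + 1)) : x i ≤ L := by
  rw [← hx.last]; exact hx.strictMono.monotone (Fin.le_last i)

lemma IsPartition.elem_subset (hx : IsPartition L x) (k : Fin N) : elem x k ⊆ Ioo 0 L :=
  Ioo_subset_Ioo (hx.nonneg _) (hx.le _)

lemma IsPartition.elem_unique (hx : IsPartition L x) {k l : Fin N} {s : ℝ} (hk : s ∈ elem x k)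
    (hl : s ∈ elem x l) : k = l := by
  by_contra hne
  rcases lt_or_gt_of_ne hne with h | h
  · have : x k.succ ≤ x l.castSucc := hx.strictMono.monotone (Fin.succ_le_castSucc_iff.2 h)
    linarith [hk.2, hl.1]
  · have : x l.succ ≤ x k.castSucc := hx.strictMono.monotone (Fin.succ_le_castSucc_iff.2 h)
    linarith [hk.1, hl.2]

lemma IsPartition.exists_elem (hx : IsPartition L x) {s : ℝ} (hs : s ∈ Ioo 0 L)
    (hn : s ∉ range x) : ∃ k, s ∈ elem x k := by
  classical
  have hne : (Finset.univ.filter fun i => x i < s).Nonempty :=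
    ⟨0, by simp [hx.first, hs.1]⟩
  set i := (Finset.univ.filter fun i => x i < s).max' hne with hi
  have hi1 : x i < s := by
    have := Finset.max'_mem _ hne
    rw [← hi] at this
    simpa using this
  have hil : i ≠ Fin.last N := by
    intro h
    rw [h, hx.last] at hi1
    exact absurd hi1 (not_lt.2 hs.2.le)
  obtain ⟨k, hk⟩ := Fin.exists_castSucc_eq.2 hil
  refine ⟨k, by rw [hk]; exact hi1, lt_of_le_of_ne ?_ fun h => hn ⟨_, h.symm⟩⟩
  by_contra! hlt
  have h1 : k.succ ≤ i := Finset.le_max' _ _ (by simpa using hlt)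
  rw [← hk] at h1
  exact absurd h1 (not_le.2 Fin.castSucc_lt_succ)

lemma IsPartition.restrict_eq (hx : IsPartition L x) :
    volume.restrict (Ioo 0 L) = volume.restrict (⋃ k, elem x k) := by
  refine Measure.restrict_congr_set ?_
  have h0 : ∀ᵐ s, s ∉ range x :=
    measure_eq_zero_iff_ae_notMem.1 ((finite_range x).measure_zero volume)
  filter_upwards [h0] with s hs
  refine propext ⟨fun h => ?_, fun h => ?_⟩
  · exact mem_iUnion.2 (hx.exists_elem h hs)
  · obtain ⟨k, hk⟩ := mem_iUnion.1 h
    exact hx.elem_subset k hk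

lemma IsPartition.ae_iff (hx : IsPartition L x) {p : ℝ → Prop} :
    (∀ᵐ s ∂volume.restrict (Ioo 0 L), p s) ↔ ∀ k, ∀ᵐ s ∂volume.restrict (elem x k), p s := by
  rw [hx.restrict_eq, ae_restrict_iUnion_iff]

lemma IsPartition.integral_eq_sum (hx : IsPartition L x) {f : ℝ → ℝ}
    (hf : IntegrableOn f (Ioo 0 L)) : ∫ s in Ioo 0 L, f s = ∑ k, ∫ s in elem x k, f s := by
  rw [hx.restrict_eq]
  refine integral_iUnion_fintype measurableSet_elem (fun k l hkl => ?_)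
    fun k => hf.mono_set (hx.elem_subset k)
  exact Set.disjoint_left.2 fun s hk hl => hkl (hx.elem_unique hk hl)

lemma inner_L2 (f g : L2 L) : ⟪f, g⟫_ℝ = ∫ s in Ioo 0 L, f s * g s := by
  rw [L2.inner_def]
  refine integral_congr_ae (ae_of_all _ fun s => ?_)
  simp [mul_comm]

lemma integrableOn_sq (f : L2 L) : IntegrableOn (fun s => f s ^ 2) (Ioo 0 L) :=
  (Lp.memLp f).integrable_sq

lemma norm_sq_L2 (f : L2 L) : ‖f‖ ^ 2 = ∫ s in Ioo 0 L, f s ^ 2 := by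
  rw [← real_inner_self_eq_norm_sq, inner_L2]
  simp only [sq]

/-- The monomial `s ^ j` on the element `k`, extended by zero. -/
noncomputable def elemMonomial (L : ℝ) (x : Fin (N + 1) → ℝ) (k : Fin N) (j : ℕ) : L2 L :=
  ((memLp_of_continuous (continuous_pow j)).indicator (measurableSet_elem (x := x) k)).toLp

lemma coeFn_elemMonomial (k : Fin N) (j : ℕ) :
    elemMonomial L x k j =ᵐ[volume.restrict (Ioo 0 L)] (elem x k).indicator fun s => s ^ j :=
  MemLp.coeFn_toLp _

/-- The functions in `L²(0, L)` that are affine on each element. -/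
noncomputable def pwAffine (L : ℝ) (x : Fin (N + 1) → ℝ) : Submodule ℝ (L2 L) :=
  Submodule.span ℝ (range fun p : Fin N × Fin 2 => elemMonomial L x p.1 p.2)

instance finiteDimensional_pwAffine : FiniteDimensional ℝ (pwAffine L x) :=
  FiniteDimensional.span_of_finite ℝ (finite_range _)

lemma elemMonomial_mem (k : Fin N) (j : Fin 2) : elemMonomial L x k j ∈ pwAffine L x :=
  Submodule.subset_span ⟨(k, j), rfl⟩

lemma IsPartition.ae_restrict_elem (hx : IsPartition L x) (k : Fin N) {p : ℝ → Prop}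
    (h : ∀ᵐ s ∂volume.restrict (Ioo 0 L), p s) : ∀ᵐ s ∂volume.restrict (elem x k), p s :=
  ae_restrict_of_ae_restrict_of_subset (hx.elem_subset k) h

/-- The span makes finite dimension evident, while the elementwise form is the one that can be
compared with derivatives of cubics. -/
lemma mem_pwAffine_iff (hx : IsPartition L x) {g : L2 L} :
    g ∈ pwAffine L x ↔
      ∀ k, ∃ α β : ℝ, ∀ᵐ s ∂volume.restrict (elem x k), g s = α + β * s := by
  constructor
  · intro hg k
    induction hg using Submodule.span_induction with
    | mem g hg =>
      obtain ⟨⟨l, j⟩, rfl⟩ := hg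
      have h1 := hx.ae_restrict_elem k (coeFn_elemMonomial (L := L) (x := x) l j)
      by_cases hkl : k = l
      · subst hkl
        refine ⟨if j = 0 then 1 else 0, if j = 0 then 0 else 1, ?_⟩
        filter_upwards [h1, ae_restrict_mem (measurableSet_elem k)] with s hs hk
        rw [hs, indicator_of_mem hk]
        fin_cases j <;> simp
      · refine ⟨0, 0, ?_⟩
        filter_upwards [h1, ae_restrict_mem (measurableSet_elem k)] with s hs hk
        rw [hs, indicator_of_notMem fun hl => hkl (hx.elem_unique hk hl)]
        simp
    | zero =>
      refine ⟨0, 0, ?_⟩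
      filter_upwards [hx.ae_restrict_elem k (Lp.coeFn_zero ℝ 2 _)] with s hs
      rw [hs]; simp
    | add f g _ _ hf hg =>
      obtain ⟨α, β, h1⟩ := hf
      obtain ⟨γ, δ, h2⟩ := hg
      refine ⟨α + γ, β + δ, ?_⟩
      filter_upwards [h1, h2, hx.ae_restrict_elem k (Lp.coeFn_add f g)] with s h1 h2 h3
      rw [h3, Pi.add_apply, h1, h2]; ring
    | smul c f _ hf =>
      obtain ⟨α, β, h1⟩ := hf
      refine ⟨c * α, c * β, ?_⟩
      filter_upwards [h1, hx.ae_restrict_elem k (Lp.coeFn_smul c f)] with s h1 h3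
      rw [h3, Pi.smul_apply, h1, smul_eq_mul]; ring
  · intro h
    choose α β h using h
    have hg : g = ∑ k, (α k • elemMonomial L x k 0 + β k • elemMonomial L x k 1) := by
      refine Lp.ext (hx.ae_iff.2 fun k => ?_)
      have h1 : ∀ l, ∀ᵐ s ∂volume.restrict (elem x k),
          (α l • elemMonomial L x l 0 + β l • elemMonomial L x l 1 : L2 L) s =
            (elem x l).indicator (fun s => α l + β l * s) s := by
        intro l
        filter_upwards [hx.ae_restrict_elem k (coeFn_elemMonomial (L := L) (x := x) l 0),
          hx.ae_restrict_elem k (coeFn_elemMonomial (L := L) (x := x) l 1),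
          hx.ae_restrict_elem k (Lp.coeFn_add (α l • elemMonomial L x l 0)
            (β l • elemMonomial L x l 1)),
          hx.ae_restrict_elem k (Lp.coeFn_smul (α l) (elemMonomial L x l 0)),
          hx.ae_restrict_elem k (Lp.coeFn_smul (β l) (elemMonomial L x l 1))] with s h1 h2 h3 h4 h5
        rw [h3, Pi.add_apply, h4, h5, Pi.smul_apply, Pi.smul_apply, h1, h2]
        by_cases hs : s ∈ elem x l <;> simp [hs]
      filter_upwards [h k, ae_all_iff.2 h1, ae_restrict_mem (measurableSet_elem k),
        hx.ae_restrict_elem k (Lp.coeFn_fun_finsetSum Finset.univ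
          fun k => (α k • elemMonomial L x k 0 + β k • elemMonomial L x k 1 : L2 L))]
        with s h2 h3 h4 h5
      rw [h2, h5]
      simp only [h3]
      rw [Finset.sum_eq_single k, indicator_of_mem h4]
      · intro l _ hl
        exact indicator_of_notMem (fun h => hl (hx.elem_unique h h4)) _
      · simp
    rw [hg]
    exact Submodule.sum_mem _ fun k _ => Submodule.add_mem _
      (Submodule.smul_mem _ _ (elemMonomial_mem k 0)) (Submodule.smul_mem _ _ (elemMonomial_mem k 1))

lemma IsPartition.integral_elem (hx : IsPartition L x) (k : Fin N) (f : ℝ → ℝ) :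
    ∫ s in elem x k, f s = ∫ s in (x k.castSucc)..(x k.succ), f s := by
  rw [intervalIntegral.integral_of_le (hx.lt k).le, integral_Ioc_eq_integral_Ioo]
  rfl

lemma inner_elemMonomial (hx : IsPartition L x) (k : Fin N) (j : ℕ) (g : L2 L) :
    ⟪elemMonomial L x k j, g⟫_ℝ = ∫ s in (x k.castSucc)..(x k.succ), extend g s * s ^ j := by
  rw [← hx.integral_elem, inner_L2]
  have h1 : ∫ s in Ioo 0 L, elemMonomial L x k j s * g s =
      ∫ s in Ioo 0 L, (elem x k).indicator (fun s => extend g s * s ^ j) s := by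
    refine integral_congr_ae ?_
    filter_upwards [coeFn_elemMonomial (L := L) (x := x) k j, ae_restrict_mem measurableSet_Ioo]
      with s hs hs'
    rw [hs]
    by_cases h : s ∈ elem x k
    · rw [indicator_of_mem h, indicator_of_mem h, extend_apply g hs', mul_comm]
    · rw [indicator_of_notMem h, indicator_of_notMem h, zero_mul]
  rw [h1, setIntegral_indicator (measurableSet_elem k), inter_eq_self_of_subset_right
    (hx.elem_subset k)]

/-- Orthogonality to the indicator of an element says that the primitive has equal values at its two
ends; start from the value 0 at the first node. -/
lemma prim_node_eq_zero (hx : IsPartition L x) {g : L2 L} (hg : g ∈ (pwAffine L x)ᗮ)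
    (i : Fin (N + 1)) : prim g (x i) = 0 := by
  induction i using Fin.induction with
  | zero => rw [hx.first, prim_zero]
  | succ k ih =>
    have h1 := prim_sub_prim g (x k.castSucc) (x k.succ)
    have h2 := (Submodule.mem_orthogonal _ g).1 hg _ (elemMonomial_mem k 0)
    rw [inner_elemMonomial hx] at h2
    simp only [Fin.val_zero, pow_zero, mul_one] at h2
    rw [h2, ih, sub_zero] at h1
    exact h1

/-- The error estimate for Hermite interpolation on one element. -/
lemma integral_elem_prim_sq_le (hx : IsPartition L x) {g : L2 L} (hg : g ∈ (pwAffine L x)ᗮ)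
    (k : Fin N) : ∫ s in elem x k, prim g s ^ 2 ≤
      ((x k.succ - x k.castSucc) / (2 * Real.pi)) ^ 2 * ∫ s in elem x k, g s ^ 2 := by
  have ha := prim_node_eq_zero hx hg k.castSucc
  have hb := prim_node_eq_zero hx hg k.succ
  -- Integrating by parts against s turns orthogonality to s on the element into mean zero of the
  -- primitive, the remaining hypothesis of `wirtinger`.
  have h1 := integral_prim_mul g (φ := id) (φ' := fun _ => 1) (fun s => hasDerivAt_id s)
    continuous_const (x k.castSucc) (x k.succ)
  have h2 := (Submodule.mem_orthogonal _ g).1 hg _ (elemMonomial_mem k 1)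
  rw [inner_elemMonomial hx] at h2
  simp only [Fin.val_one, pow_one] at h2
  simp only [ha, hb, mul_one, zero_mul, sub_zero, id, h2] at h1
  have h3 := wirtinger g (hx.lt k) ha hb h1
  rw [← hx.integral_elem, ← hx.integral_elem] at h3
  refine h3.trans (le_of_eq ?_)
  congr 1
  exact setIntegral_congr_fun (measurableSet_elem k) fun s hs => by
    simp only [extend_apply g (hx.elem_subset k hs)]

/-- The error estimate for Hermite interpolation, with weights `τ k` on the elements. -/
lemma norm_primCLM_sq_le (hx : IsPartition L x) {g : L2 L} (hg : g ∈ (pwAffine L x)ᗮ)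
    {τ : Fin N → ℝ} {C : ℝ}
    (hC : ∀ k, ((x k.succ - x k.castSucc) / (2 * Real.pi)) ^ 2 ≤ C * τ k) :
    ‖primCLM L g‖ ^ 2 ≤ C * ∑ k, τ k * ∫ s in elem x k, g s ^ 2 := by
  have h1 : ∫ s in Ioo 0 L, primCLM L g s ^ 2 = ∫ s in Ioo 0 L, prim g s ^ 2 := by
    refine integral_congr_ae ?_
    filter_upwards [coeFn_primCLM g] with s hs
    rw [hs]
  rw [norm_sq_L2, h1, hx.integral_eq_sum (memLp_prim g).integrable_sq, Finset.mul_sum]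
  refine Finset.sum_le_sum fun k _ => (integral_elem_prim_sq_le hx hg k).trans ?_
  rw [← mul_assoc]
  exact mul_le_mul_of_nonneg_right (hC k) (integral_nonneg fun s => sq_nonneg _)

lemma isPartition_uniform (hL : 0 < L) (n : ℕ) :
    IsPartition L (fun i : Fin (n + 1 + 1) => (i : ℝ) * (L / (n + 1))) where
  strictMono i j hij := by
    have : ((i : ℕ) : ℝ) < (j : ℕ) := by exact_mod_cast hij
    have h : 0 < L / ((n : ℝ) + 1) := by positivity
    exact mul_lt_mul_of_pos_right this h
  first := by simp
  last := by
    simp only [Fin.val_last]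
    push_cast
    field_simp

/-- The primitive is a compact operator on `L²(0, L)`. -/
theorem isCompactOperator_primCLM (hL : 0 < L) : IsCompactOperator (primCLM L) := by
  let y (n : ℕ) : Fin (n + 1 + 1) → ℝ := fun i => (i : ℝ) * (L / (n + 1))
  -- Projecting onto the piecewise affine functions of a uniform mesh with n + 1 elements gives
  -- finite-rank approximations, within L/(2π(n + 1)) in operator norm.
  refine isCompactOperator_of_tendsto (l := atTop)
    (F := fun n => primCLM L ∘L (pwAffine L (y n)).starProjection) ?_
    (Eventually.of_forall fun n => ?_)
  · rw [tendsto_iff_norm_sub_tendsto_zero]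
    have hlim : Tendsto (fun n : ℕ => L / (2 * Real.pi) * (1 / ((n : ℝ) + 1))) atTop (𝓝 0) := by
      simpa using tendsto_one_div_add_atTop_nhds_zero_nat.const_mul (L / (2 * Real.pi))
    refine squeeze_zero (fun n => norm_nonneg _) (fun n => ?_) hlim
    have hc : 0 ≤ L / (2 * Real.pi) * (1 / ((n : ℝ) + 1)) := by
      have := Real.pi_pos
      positivity
    refine ContinuousLinearMap.opNorm_le_bound _ hc fun f => ?_
    have hx := isPartition_uniform hL n
    set S := pwAffine L (y n)
    set c := L / (2 * Real.pi) * (1 / ((n : ℝ) + 1))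
    have hg : f - S.starProjection f ∈ Sᗮ := Submodule.sub_starProjection_mem_orthogonal f
    have h1 := norm_primCLM_sq_le hx hg (τ := fun _ => 1) (C := c ^ 2) (fun k => le_of_eq (by
      simp only [Fin.val_succ, Fin.val_castSucc, c]
      push_cast
      field_simp
      ring))
    simp only [one_mul] at h1
    rw [← hx.integral_eq_sum (integrableOn_sq _), ← norm_sq_L2, ← mul_pow] at h1
    have h2 := le_of_sq_le_sq h1 (by positivity)
    have h3 : ‖f - S.starProjection f‖ ≤ ‖f‖ := by
      rw [← S.starProjection_orthogonal_val]
      refine (Sᗮ.starProjection.le_opNorm f).trans ?_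
      exact mul_le_of_le_one_left (norm_nonneg _) Sᗮ.starProjection_norm_le
    have h4 : ((primCLM L ∘L S.starProjection - primCLM L : L2 L →L[ℝ] L2 L)) f =
        -(primCLM L (f - S.starProjection f)) := by
      simp
    rw [h4, norm_neg]
    exact h2.trans (mul_le_mul_of_nonneg_left h3 hc)
  · have : IsCompactOperator (pwAffine L (y n)).orthogonalProjectionOnto :=
      isCompactOperator_of_locallyCompactSpace_dom _
    exact (this.clm_comp (pwAffine L (y n)).subtypeL).clm_comp (primCLM L)

end Elements

/-! ### Step-function weights and the end conditions as moment conditions. -/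

section Multiplication

open Filter Topology
open scoped InnerProductSpace ENNReal

variable {L : ℝ} {N : ℕ} {x : Fin (N + 1) → ℝ}

/-- The function with the constant value `c k` on the element `k`. -/
noncomputable def stepFun (x : Fin (N + 1) → ℝ) (c : Fin N → ℝ) (s : ℝ) : ℝ :=
  ∑ k, (elem x k).indicator (fun _ => c k) s

lemma stepFun_apply (hx : IsPartition L x) (c : Fin N → ℝ) {k : Fin N} {s : ℝ}
    (hs : s ∈ elem x k) : stepFun x c s = c k := by
  rw [stepFun, Finset.sum_eq_single k, indicator_of_mem hs]
  · intro l _ hl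
    exact indicator_of_notMem (fun h => hl (hx.elem_unique h hs)) _
  · simp

lemma memLp_stepFun (c : Fin N → ℝ) :
    MemLp (stepFun x c) ∞ (volume.restrict (Ioo (0 : ℝ) L)) :=
  memLp_finsetSum _ fun k _ => (memLp_const (c k)).indicator (measurableSet_elem k)

/-- Multiplication by a step function on `L²(0, L)`. -/
noncomputable def mulStep (L : ℝ) (x : Fin (N + 1) → ℝ) (c : Fin N → ℝ) : L2 L →L[ℝ] L2 L :=
  (ContinuousLinearMap.mul ℝ ℝ).holderL (volume.restrict (Ioo (0 : ℝ) L)) ∞ 2 2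
    (memLp_stepFun (x := x) c).toLp

lemma coeFn_mulStep (hx : IsPartition L x) (c : Fin N → ℝ) (f : L2 L) (k : Fin N) :
    ∀ᵐ s ∂volume.restrict (elem x k), mulStep L x c f s = c k * f s := by
  have h1 := (ContinuousLinearMap.mul ℝ ℝ).coeFn_holder (p := ∞) (q := 2) (r := 2)
    ((memLp_stepFun (x := x) (L := L) c).toLp) f
  filter_upwards [hx.ae_restrict_elem k h1,
    hx.ae_restrict_elem k (memLp_stepFun (x := x) (L := L) c).coeFn_toLp,
    ae_restrict_mem (measurableSet_elem k)] with s h1 h2 h3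
  change (ContinuousLinearMap.mul ℝ ℝ).holder 2 _ f s = _
  rw [h1, h2, stepFun_apply hx c h3]
  rfl

lemma mulStep_mulStep (hx : IsPartition L x) {c d : Fin N → ℝ} (hcd : ∀ k, c k * d k = 1)
    (f : L2 L) : mulStep L x c (mulStep L x d f) = f := by
  refine Lp.ext (hx.ae_iff.2 fun k => ?_)
  filter_upwards [coeFn_mulStep hx c (mulStep L x d f) k, coeFn_mulStep hx d f k] with s h1 h2
  rw [h1, h2, ← mul_assoc, hcd, one_mul]

lemma inner_mulStep (hx : IsPartition L x) (c : Fin N → ℝ) (f g : L2 L) :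
    ⟪mulStep L x c f, g⟫_ℝ = ⟪f, mulStep L x c g⟫_ℝ := by
  rw [inner_L2, inner_L2]
  refine integral_congr_ae (hx.ae_iff.2 fun k => ?_)
  filter_upwards [coeFn_mulStep hx c f k, coeFn_mulStep hx c g k] with s h1 h2
  rw [h1, h2]
  ring

/-- This uses that the weight is constant on each element, and is why the mesh must be aligned with
the steps. -/
lemma mulStep_mem_pwAffine (hx : IsPartition L x) (c : Fin N → ℝ) {f : L2 L}
    (hf : f ∈ pwAffine L x) : mulStep L x c f ∈ pwAffine L x := by
  refine (mem_pwAffine_iff hx).2 fun k => ?_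
  obtain ⟨α, β, h⟩ := (mem_pwAffine_iff hx).1 hf k
  refine ⟨c k * α, c k * β, ?_⟩
  filter_upwards [h, coeFn_mulStep hx c f k] with s h1 h2
  rw [h2, h1]
  ring

/-- A self-adjoint operator that preserves a subspace preserves its orthogonal complement. -/
lemma mulStep_mem_orthogonal (hx : IsPartition L x) (c : Fin N → ℝ) {f : L2 L}
    (hf : f ∈ (pwAffine L x)ᗮ) : mulStep L x c f ∈ (pwAffine L x)ᗮ := by
  refine (Submodule.mem_orthogonal _ _).2 fun u hu => ?_
  rw [← inner_mulStep hx]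
  exact (Submodule.mem_orthogonal _ f).1 hf _ (mulStep_mem_pwAffine hx c hu)

/-- The monomial `s ^ j` in `L²(0, L)`. -/
noncomputable def monomialL2 (L : ℝ) (j : ℕ) : L2 L :=
  (memLp_of_continuous (continuous_pow j)).toLp

lemma coeFn_monomialL2 (j : ℕ) :
    monomialL2 L j =ᵐ[volume.restrict (Ioo 0 L)] fun s => s ^ j :=
  MemLp.coeFn_toLp _

lemma monomialL2_mem_pwAffine (hx : IsPartition L x) (j : Fin 2) :
    monomialL2 L j ∈ pwAffine L x := by
  refine (mem_pwAffine_iff hx).2 fun k =>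
    ⟨if j = 0 then 1 else 0, if j = 0 then 0 else 1, ?_⟩
  filter_upwards [hx.ae_restrict_elem k (coeFn_monomialL2 (L := L) j)] with s hs
  rw [hs]
  fin_cases j <;> simp

lemma inner_monomialL2 (hL : 0 ≤ L) (j : ℕ) (g : L2 L) :
    ⟪monomialL2 L j, g⟫_ℝ = ∫ s in (0 : ℝ)..L, extend g s * s ^ j := by
  rw [inner_L2, ← integral_Ioo_eq hL]
  refine integral_congr_ae ?_
  filter_upwards [coeFn_monomialL2 (L := L) j, ae_restrict_mem measurableSet_Ioo] with s h1 h2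
  rw [h1, extend_apply g h2, mul_comm]

lemma prim_eq_inner (hL : 0 ≤ L) (g : L2 L) : prim g L = ⟪monomialL2 L 0, g⟫_ℝ := by
  rw [inner_monomialL2 hL]
  simp [prim]

/-- One integration by parts. Together with `prim_eq_inner` it turns u(L) = u'(L) = 0 into the
vanishing of the moments of u'' against 1 and s. -/
lemma prim_primCLM_eq_inner (hL : 0 ≤ L) (g : L2 L) :
    prim (primCLM L g) L = L * ⟪monomialL2 L 0, g⟫_ℝ - ⟪monomialL2 L 1, g⟫_ℝ := by
  have h1 := integral_prim_mul g (φ := id) (φ' := fun _ => 1) (fun s => hasDerivAt_id s)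
    continuous_const 0 L
  have h2 : prim (primCLM L g) L = ∫ s in (0 : ℝ)..L, prim g s := by
    rw [prim, ← integral_Ioo_eq hL, ← integral_Ioo_eq hL]
    refine integral_congr_ae ?_
    filter_upwards [coeFn_primCLM g, ae_restrict_mem measurableSet_Ioo] with s h1 h2
    rw [extend_apply _ h2, h1]
  rw [← prim_eq_inner hL, inner_monomialL2 hL, h2]
  simp only [mul_one, id, prim_zero, zero_mul, sub_zero] at h1
  simp only [pow_one]
  rw [h1, mul_comm]

/-- The span of `1 / c` and `s / c` where `c` is a step function with inverse `d`. -/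
noncomputable def momentSpan (L : ℝ) (x : Fin (N + 1) → ℝ) (d : Fin N → ℝ) : Submodule ℝ (L2 L) :=
  Submodule.span ℝ (range fun j : Fin 2 => mulStep L x d (monomialL2 L j))

instance finiteDimensional_momentSpan (d : Fin N → ℝ) :
    FiniteDimensional ℝ (momentSpan L x d) :=
  FiniteDimensional.span_of_finite ℝ (finite_range _)

lemma momentSpan_le (hx : IsPartition L x) (d : Fin N → ℝ) :
    momentSpan L x d ≤ pwAffine L x := by
  refine Submodule.span_le.2 ?_
  rintro _ ⟨j, rfl⟩
  exact mulStep_mem_pwAffine hx d (monomialL2_mem_pwAffine hx j)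

lemma mem_momentSpan_orthogonal (hL : 0 < L) (hx : IsPartition L x) (d : Fin N → ℝ) {f : L2 L} :
    f ∈ (momentSpan L x d)ᗮ ↔
      prim (mulStep L x d f) L = 0 ∧ prim (primCLM L (mulStep L x d f)) L = 0 := by
  rw [prim_primCLM_eq_inner hL.le, prim_eq_inner hL.le, ← inner_mulStep hx, ← inner_mulStep hx]
  constructor
  · intro h
    have h0 := (Submodule.mem_orthogonal _ f).1 h _ (Submodule.subset_span ⟨0, rfl⟩)
    have h1 := (Submodule.mem_orthogonal _ f).1 h _ (Submodule.subset_span ⟨1, rfl⟩)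
    simp only [Fin.val_zero, Fin.val_one] at h0 h1
    rw [h0, h1]
    simp
  · rintro ⟨h0, h1⟩
    rw [h0, mul_zero, zero_sub, neg_eq_zero] at h1
    refine (Submodule.mem_orthogonal _ f).2 fun u hu => ?_
    induction hu using Submodule.span_induction with
    | mem u hu =>
      obtain ⟨j, rfl⟩ := hu
      fin_cases j
      · exact h0
      · exact h1
    | zero => simp
    | add u v _ _ hu hv => rw [inner_add_left, hu, hv, add_zero]
    | smul a u _ hu => rw [inner_smul_left, hu, mul_zero]

/-- A vector orthogonal to `D` and to the part of `S` orthogonal to `D` is orthogonal to `S`. -/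
lemma mem_orthogonal_of_inf {E : Type*} [NormedAddCommGroup E] [InnerProductSpace ℝ E]
    {D S : Submodule ℝ E} [FiniteDimensional ℝ S] (hDS : D ≤ S) {f : E} (hf : f ∈ Dᗮ)
    (h : ∀ u ∈ S, u ∈ Dᗮ → ⟪u, f⟫_ℝ = 0) : f ∈ Sᗮ := by
  obtain ⟨p, hp, q, hq, rfl⟩ := S.exists_add_mem_mem_orthogonal f
  have hpD : p ∈ Dᗮ := by
    have := Submodule.sub_mem _ hf (Submodule.orthogonal_le hDS hq)
    rwa [add_sub_cancel_right] at this
  have h1 := h p hp hpD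
  rw [inner_add_right, (Submodule.mem_orthogonal _ q).1 hq p hp, add_zero] at h1
  rw [inner_self_eq_zero.1 h1, zero_add]
  exact hq

/-- In finite dimension the injective operator `primCLM L` would be onto, but the constant 1 is not
a primitive that vanishes at 0. -/
lemma not_finiteDimensional_L2 (hL : 0 < L) : ¬ FiniteDimensional ℝ (L2 L) := by
  intro hfd
  have hs : Function.Surjective (primCLM L : L2 L →ₗ[ℝ] L2 L) :=
    LinearMap.injective_iff_surjective.1 injective_primCLM
  obtain ⟨g, hg⟩ := hs (monomialL2 L 0)
  have h1 : prim g =ᵐ[volume.restrict (Icc 0 L)] fun _ => 1 := by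
    rw [← restrict_Ioo_eq_restrict_Icc]
    have h2 := coeFn_primCLM g
    rw [show primCLM L g = monomialL2 L 0 from hg] at h2
    filter_upwards [h2, coeFn_monomialL2 (L := L) 0] with s h3 h4
    rw [← h3, h4, pow_zero]
  have h5 := Measure.eqOn_Icc_of_ae_eq volume hL.ne h1 (continuous_prim g).continuousOn
    continuousOn_const (left_mem_Icc.2 hL.le)
  simp [prim_zero] at h5

lemma not_finiteDimensional_orthogonal {E : Type*} [NormedAddCommGroup E] [InnerProductSpace ℝ E]
    (hE : ¬ FiniteDimensional ℝ E) (D : Submodule ℝ E) [FiniteDimensional ℝ D] :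
    ¬ FiniteDimensional ℝ Dᗮ := by
  intro h
  have h1 : D ⊔ Dᗮ = ⊤ := Submodule.sup_orthogonal_of_hasOrthogonalProjection
  have h2 : FiniteDimensional ℝ (D ⊔ Dᗮ : Submodule ℝ E) := inferInstance
  rw [h1] at h2
  exact hE (Module.Finite.equiv (Submodule.topEquiv (R := ℝ) (M := E)))

end Multiplication

/-! ### Transfer of the spaces, forms and eigenvalue lists to weighted second derivatives. -/

section Spaces

open Filter Topology
open scoped InnerProductSpace ENNReal

variable {L : ℝ} {N : ℕ} {x : Fin (N + 1) → ℝ}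

/-- If `u` agrees with a polynomial on an element, so does the function of which it is the
primitive, with the derivative of the polynomial. -/
lemma ae_eq_derivative (hx : IsPartition L x) {g : L2 L} {k : Fin N} {p : ℝ[X]}
    (h : ∀ᵐ s ∂volume.restrict (elem x k), primCLM L g s = p.eval s) :
    ∀ᵐ s ∂volume.restrict (elem x k), g s = p.derivative.eval s := by
  have h1 : prim g =ᵐ[volume.restrict (elem x k)] fun s => p.eval s := by
    filter_upwards [h, hx.ae_restrict_elem k (coeFn_primCLM g)] with s h1 h2
    rw [← h2, h1]
  have h2 : EqOn (prim g) (fun s => p.eval s) (elem x k) :=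
    Measure.eqOn_open_of_ae_eq h1 isOpen_Ioo (continuous_prim g).continuousOn
      p.continuous.continuousOn
  filter_upwards [ae_restrict_of_ae (ae_hasDerivAt_prim g), ae_restrict_mem (measurableSet_elem k)]
    with s h3 h4
  rw [extend_apply g (hx.elem_subset k h4)] at h3
  have h5 : prim g =ᶠ[𝓝 s] fun s => p.eval s :=
    h2.eventuallyEq_of_mem (isOpen_Ioo.mem_nhds h4)
  exact h3.unique ((p.hasDerivAt s).congr_of_eventuallyEq h5)

/-- The primitive of a function that is given by a continuous function on an element. -/
lemma exists_prim_eq (hx : IsPartition L x) {g : L2 L} {k : Fin N} {p p' : ℝ → ℝ}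
    (hp : ∀ s, HasDerivAt p (p' s) s) (hp' : Continuous p')
    (h : ∀ᵐ s ∂volume.restrict (elem x k), g s = p' s) :
    ∃ C : ℝ, ∀ s ∈ Icc (x k.castSucc) (x k.succ), prim g s = C + p s := by
  refine ⟨prim g (x k.castSucc) - p (x k.castSucc), fun s hs => ?_⟩
  have h1 := prim_sub_prim g (x k.castSucc) s
  have h2 : ∫ τ in (x k.castSucc)..s, extend g τ = ∫ τ in (x k.castSucc)..s, p' τ := by
    rw [intervalIntegral.integral_of_le hs.1, intervalIntegral.integral_of_le hs.1,
      integral_Ioc_eq_integral_Ioo, integral_Ioc_eq_integral_Ioo]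
    refine integral_congr_ae ?_
    have hsub : Ioo (x k.castSucc) s ⊆ elem x k := Ioo_subset_Ioo le_rfl hs.2
    filter_upwards [ae_restrict_of_ae_restrict_of_subset hsub h,
      ae_restrict_mem measurableSet_Ioo] with τ h3 h4
    rw [extend_apply g (hx.elem_subset k (hsub h4)), h3]
  rw [h2, intervalIntegral.integral_eq_sub_of_hasDerivAt (fun τ _ => hp τ)
    (hp'.intervalIntegrable _ _)] at h1
  linarith

/-- Recovers an element of `H²₀(0, L)` from its weighted second derivative. -/
noncomputable def reconstruct (L : ℝ) (x : Fin (N + 1) → ℝ) (d : Fin N → ℝ) : L2 L →L[ℝ] L2 L :=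
  primCLM L ∘L primCLM L ∘L mulStep L x d

lemma injective_mulStep (hx : IsPartition L x) {c d : Fin N → ℝ} (hcd : ∀ k, c k * d k = 1) :
    Function.Injective (mulStep L x d) :=
  Function.LeftInverse.injective (mulStep_mulStep hx hcd)

lemma injective_reconstruct (hx : IsPartition L x) {c d : Fin N → ℝ}
    (hcd : ∀ k, c k * d k = 1) : Function.Injective (reconstruct L x d) :=
  injective_primCLM.comp (injective_primCLM.comp (injective_mulStep hx hcd))

lemma mem_H20_iff_reconstruct (hL : 0 < L) (hx : IsPartition L x) {c d : Fin N → ℝ}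
    (hcd : ∀ k, c k * d k = 1) {u : L2 L} :
    u ∈ H20 L ↔ ∃ f ∈ (momentSpan L x d)ᗮ, reconstruct L x d f = u := by
  rw [mem_H20_iff hL]
  constructor
  · rintro ⟨g, h1, h2, rfl⟩
    have h3 : mulStep L x d (mulStep L x c g) = g :=
      mulStep_mulStep hx (fun k => by rw [mul_comm, hcd]) g
    refine ⟨mulStep L x c g, (mem_momentSpan_orthogonal hL hx d).2 ?_, ?_⟩
    · rw [h3]; exact ⟨h1, h2⟩
    · simp only [reconstruct, ContinuousLinearMap.comp_apply, h3]
  · rintro ⟨f, hf, rfl⟩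
    obtain ⟨h1, h2⟩ := (mem_momentSpan_orthogonal hL hx d).1 hf
    exact ⟨_, h1, h2, rfl⟩

/-- A function in H²₀ is cubic on an element exactly when its second derivative is affine there, and
multiplication by c or d keeps that property. -/
lemma mem_hermiteSpace_iff (hL : 0 < L) (hx : IsPartition L x) {c d : Fin N → ℝ}
    (hcd : ∀ k, c k * d k = 1) {u : L2 L} :
    u ∈ hermiteSpace L x ↔
      ∃ f ∈ (momentSpan L x d)ᗮ, f ∈ pwAffine L x ∧ reconstruct L x d f = u := by
  constructor
  · rintro ⟨hu, hp⟩
    obtain ⟨f, hf, rfl⟩ := (mem_H20_iff_reconstruct hL hx hcd).1 hu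
    refine ⟨f, hf, ?_, rfl⟩
    suffices h : mulStep L x d f ∈ pwAffine L x by
      have := mulStep_mem_pwAffine hx c h
      rwa [mulStep_mulStep hx hcd] at this
    refine (mem_pwAffine_iff hx).2 fun k => ?_
    obtain ⟨p, p1, p2⟩ := hp k
    have h1 : ∀ᵐ s ∂volume.restrict (elem x k), reconstruct L x d f s = p.eval s := by
      filter_upwards [hx.ae_restrict_elem k p2, ae_restrict_mem (measurableSet_elem k)]
        with s h1 h2 using h1 (Ioo_subset_Icc_self h2)
    have h2 : ∀ᵐ s ∂volume.restrict (elem x k),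
        mulStep L x d f s = p.derivative.derivative.eval s :=
      ae_eq_derivative hx (ae_eq_derivative hx h1)
    have hdeg : p.derivative.derivative.natDegree ≤ 1 := by
      have h3 : p.natDegree ≤ 3 := Polynomial.natDegree_le_of_degree_le p1
      have h4 := p.natDegree_derivative_le
      have h5 := p.derivative.natDegree_derivative_le
      omega
    obtain ⟨β, α, h6⟩ := Polynomial.exists_eq_X_add_C_of_natDegree_le_one hdeg
    refine ⟨α, β, ?_⟩
    filter_upwards [h2] with s h7
    rw [h7, h6]
    simp
    ring
  · rintro ⟨f, hf, hf', rfl⟩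
    refine ⟨(mem_H20_iff_reconstruct hL hx hcd).2 ⟨f, hf, rfl⟩, fun k => ?_⟩
    set g := mulStep L x d f with hg
    obtain ⟨α, β, h1⟩ := (mem_pwAffine_iff hx).1 (mulStep_mem_pwAffine hx d hf') k
    obtain ⟨C, h2⟩ := exists_prim_eq hx (p := fun s => α * s + β * (s ^ 2 / 2))
      (p' := fun s => α + β * s) (fun s => by
        have ha := (hasDerivAt_id s).const_mul α
        have hb := ((hasDerivAt_pow 2 s).div_const 2).const_mul β
        convert! ha.add hb using 1
        simp) (by fun_prop) h1
    have h3 : ∀ᵐ s ∂volume.restrict (elem x k),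
        primCLM L g s = C + (α * s + β * (s ^ 2 / 2)) := by
      filter_upwards [hx.ae_restrict_elem k (coeFn_primCLM g),
        ae_restrict_mem (measurableSet_elem k)] with s h3 h4
      rw [h3, h2 s (Ioo_subset_Icc_self h4)]
    obtain ⟨D, h4⟩ := exists_prim_eq hx
      (p := fun s => C * s + (α * (s ^ 2 / 2) + β * (s ^ 3 / 6)))
      (p' := fun s => C + (α * s + β * (s ^ 2 / 2))) (fun s => by
        have ha := (hasDerivAt_id s).const_mul C
        have hb := ((hasDerivAt_pow 2 s).div_const 2).const_mul α
        have hc := ((hasDerivAt_pow 3 s).div_const 6).const_mul β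
        convert! ha.add (hb.add hc) using 1
        simp only [Nat.cast_ofNat, Nat.reduceSub, pow_one]
        ring) (by fun_prop) h3
    refine ⟨Polynomial.C D + (Polynomial.C C * Polynomial.X +
      (Polynomial.C (α / 2) * Polynomial.X ^ 2 + Polynomial.C (β / 6) * Polynomial.X ^ 3)),
      by compute_degree, ?_⟩
    filter_upwards [coeFn_primCLM (primCLM L g)] with s h5 h6
    change primCLM L (primCLM L g) s = _
    rw [h5, h4 s h6]
    simp
    ring

lemma bendingForm_reconstruct (hx : IsPartition L x) {c d : Fin N → ℝ}
    (hcd : ∀ k, c k * d k = 1) {κ : ℝ → ℝ} (hκ : ∀ k, ∀ s ∈ elem x k, κ s = c k ^ 2)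
    (f g : L2 L) :
    bendingForm κ (reconstruct L x d f) (reconstruct L x d g) = ⟪f, g⟫_ℝ := by
  rw [bendingForm, inner_L2]
  simp only [reconstruct, ContinuousLinearMap.comp_apply, weakDeriv_primCLM]
  refine integral_congr_ae (hx.ae_iff.2 fun k => ?_)
  filter_upwards [coeFn_mulStep hx d f k, coeFn_mulStep hx d g k,
    ae_restrict_mem (measurableSet_elem k)] with s h1 h2 h3
  rw [h1, h2, hκ k s h3]
  -- The stiffness c² meets one factor d from each argument, and (cd)² - 1 = (cd + 1)(cd - 1).
  linear_combination f s * g s * (c k * d k + 1) * hcd k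

lemma bucklingForm_reconstruct (d : Fin N → ℝ) (f g : L2 L) :
    bucklingForm (reconstruct L x d f) (reconstruct L x d g) =
      ⟪primCLM L (mulStep L x d f), primCLM L (mulStep L x d g)⟫_ℝ := by
  rw [bucklingForm, inner_L2]
  simp only [reconstruct, ContinuousLinearMap.comp_apply, weakDeriv_primCLM]

/-- The buckling problem on the range of `j` is the abstract eigenvalue problem if `j` carries the
forms over. -/
lemma listsEigenvalues_iff {H K : Type} [NormedAddCommGroup H] [InnerProductSpace ℝ H]
    [NormedAddCommGroup K] [InnerProductSpace ℝ K] (B : H →L[ℝ] K) {κ : ℝ → ℝ}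
    {W : Submodule ℝ (L2 L)} {j : H →ₗ[ℝ] L2 L} (hj : Function.Injective j)
    (hW : LinearMap.range j = W) (h1 : ∀ f k, bendingForm κ (j f) (j k) = ⟪f, k⟫_ℝ)
    (h2 : ∀ f k, bucklingForm (j f) (j k) = ⟪B f, B k⟫_ℝ) {ι : Type} [Preorder ι] {lam : ι → ℝ} :
    ListsEigenvalues κ W lam ↔ ListsFormEigenvalues B lam := by
  have key : ∀ μ, eigenspace κ W μ = (formEigenspace B μ).map j := by
    intro μ
    -- `eigenspace` is defined as a span, but its generating set is already a subspace, so the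
    -- generating sets can be compared directly.
    rw [← Submodule.span_eq ((formEigenspace B μ).map j), eigenspace]
    congr 1
    ext u
    rw [← hW]
    constructor
    · rintro ⟨⟨f, rfl⟩, hf⟩
      refine ⟨f, fun k => ?_, rfl⟩
      rw [← h1, ← h2]
      exact hf _ ⟨k, rfl⟩
    · rintro ⟨f, hf, rfl⟩
      refine ⟨⟨f, rfl⟩, ?_⟩
      rintro _ ⟨k, rfl⟩
      rw [h1, h2]
      exact hf k
  have hrank : ∀ μ, Module.rank ℝ (eigenspace κ W μ) = Module.rank ℝ (formEigenspace B μ) := by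
    intro μ
    rw [key]
    exact (Submodule.equivMapOfInjective j hj (formEigenspace B μ)).rank_eq.symm
  simp only [ListsEigenvalues, ListsFormEigenvalues, hrank]

/-- Scaling the stiffness scales the eigenvalues. -/
lemma listsEigenvalues_const_mul {κ κ' : ℝ → ℝ} {a : ℝ} (ha : 0 < a) (hκ : ∀ s, κ' s = a * κ s)
    (W : Submodule ℝ (L2 L)) {ι : Type} [Preorder ι] {P : ι → ℝ} :
    ListsEigenvalues κ' W P ↔ ListsEigenvalues κ W (fun i => P i / a) := by
  have hb : ∀ u v : L2 L, bendingForm κ' u v = a * bendingForm κ u v := by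
    intro u v
    rw [bendingForm, bendingForm, ← integral_const_mul]
    simp only [hκ, mul_assoc]
  have he : ∀ μ, eigenspace κ' W (a * μ) = eigenspace κ W μ := by
    intro μ
    simp only [eigenspace, hb, mul_assoc, mul_right_inj' ha.ne']
  have hset : ∀ μ, {i | P i / a = μ} = {i | P i = a * μ} := by
    intro μ
    ext i
    change P i / a = μ ↔ P i = a * μ
    rw [div_eq_iff ha.ne', mul_comm]
  refine and_congr ⟨fun h i k hik => ?_, fun h i k hik => ?_⟩ ⟨fun h μ => ?_, fun h μ => ?_⟩
  · exact div_le_div_of_nonneg_right (h hik) ha.le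
  · exact (div_le_div_iff_of_pos_right ha).1 (h hik)
  · rw [hset, h, he]
  · have h1 := h (μ / a)
    rw [hset, ← he, mul_div_cancel₀ _ ha.ne'] at h1
    exact h1

end Spaces

/-! ### Assembly for the stepped beam. -/

section Main

open scoped InnerProductSpace

variable {L : ℝ} {N : ℕ} {x : Fin (N + 1) → ℝ}

/-- The projection error estimate that enters the eigenvalue bounds. -/
lemma norm_sq_le_of_orthogonal (hx : IsPartition L x) {c d τ : Fin N → ℝ}
    (hcd : ∀ k, c k * d k = 1) (hc : ∀ k, c k ^ 2 = τ k) {C : ℝ}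
    (hC : ∀ k, ((x k.succ - x k.castSucc) / (2 * Real.pi)) ^ 2 ≤ C * τ k) {f : L2 L}
    (hf : f ∈ (pwAffine L x)ᗮ) : ‖primCLM L (mulStep L x d f)‖ ^ 2 ≤ C * ‖f‖ ^ 2 := by
  have h1 := norm_primCLM_sq_le hx (mulStep_mem_orthogonal hx d hf) hC
  have h2 : ∀ k, τ k * ∫ s in elem x k, mulStep L x d f s ^ 2 = ∫ s in elem x k, f s ^ 2 := by
    intro k
    rw [← integral_const_mul]
    refine integral_congr_ae ?_
    filter_upwards [coeFn_mulStep hx d f k] with s hs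
    rw [hs, ← hc k]
    linear_combination f s ^ 2 * (c k * d k + 1) * hcd k
  simp only [h2] at h1
  rwa [← hx.integral_eq_sum (integrableOn_sq f), ← norm_sq_L2] at h1

/-- The weighted second derivatives of the elements of `H²₀(0, L)`. -/
noncomputable abbrev weightedSpace (L : ℝ) (x : Fin (N + 1) → ℝ) (d : Fin N → ℝ) : Submodule ℝ (L2 L) :=
  (momentSpan L x d)ᗮ

/-- The weighted second derivatives of the elements of the Hermite space. -/
noncomputable def weightedHermite (L : ℝ) (x : Fin (N + 1) → ℝ) (d : Fin N → ℝ) :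
    Submodule ℝ (weightedSpace L x d) :=
  (pwAffine L x).comap (weightedSpace L x d).subtype

/-- The operator that recovers the first derivative from the weighted second derivative. -/
noncomputable def bucklingOp (L : ℝ) (x : Fin (N + 1) → ℝ) (d : Fin N → ℝ) :
    weightedSpace L x d →L[ℝ] L2 L :=
  restrictOp (primCLM L ∘L mulStep L x d) (weightedSpace L x d)

lemma bucklingOp_apply (d : Fin N → ℝ) (f : weightedSpace L x d) :
    bucklingOp L x d f = primCLM L (mulStep L x d (f : L2 L)) := rfl

instance finiteDimensional_weightedHermite (d : Fin N → ℝ) :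
    FiniteDimensional ℝ (weightedHermite L x d) := by
  refine FiniteDimensional.of_injective (V₂ := pwAffine L x)
    (((weightedSpace L x d).subtype ∘ₗ (weightedHermite L x d).subtype).codRestrict (pwAffine L x)
      fun w => w.2) fun v w h => Subtype.ext (Subtype.ext ?_)
  exact congrArg (fun z : pwAffine L x => (z : L2 L)) h

lemma isCompactOperator_bucklingOp (hL : 0 < L) (d : Fin N → ℝ) :
    IsCompactOperator (bucklingOp L x d) :=
  isCompactOperator_restrictOp ((isCompactOperator_primCLM hL).comp_clm (mulStep L x d)) _

lemma injective_bucklingOp (hx : IsPartition L x) {c d : Fin N → ℝ} (hcd : ∀ k, c k * d k = 1) :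
    Function.Injective (bucklingOp L x d) :=
  injective_restrictOp (B := primCLM L ∘L mulStep L x d)
    (injective_primCLM.comp (injective_mulStep hx hcd)) _

lemma listsEigenvalues_H20_iff (hL : 0 < L) (hx : IsPartition L x) {c d : Fin N → ℝ}
    (hcd : ∀ k, c k * d k = 1) {κ : ℝ → ℝ} (hκ : ∀ k, ∀ s ∈ elem x k, κ s = c k ^ 2)
    {ι : Type} [Preorder ι] {lam : ι → ℝ} :
    ListsEigenvalues κ (H20 L) lam ↔ ListsFormEigenvalues (bucklingOp L x d) lam := by
  refine listsEigenvalues_iff (bucklingOp L x d)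
    (j := (reconstruct L x d : L2 L →ₗ[ℝ] L2 L) ∘ₗ (weightedSpace L x d).subtype)
    ((injective_reconstruct hx hcd).comp Subtype.val_injective) ?_
    (fun f k => ?_) (fun f k => ?_)
  rotate_left
  · exact bendingForm_reconstruct hx hcd hκ (f : L2 L) (k : L2 L)
  · rw [bucklingOp_apply, bucklingOp_apply, ← bucklingForm_reconstruct]
    rfl
  ext u
  rw [mem_H20_iff_reconstruct hL hx hcd]
  exact ⟨fun ⟨f, hf⟩ => ⟨f, f.2, hf⟩, fun ⟨f, hf, hf'⟩ => ⟨⟨f, hf⟩, hf'⟩⟩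

lemma range_reconstruct_weightedHermite (hL : 0 < L) (hx : IsPartition L x) {c d : Fin N → ℝ}
    (hcd : ∀ k, c k * d k = 1) :
    LinearMap.range (((reconstruct L x d : L2 L →ₗ[ℝ] L2 L) ∘ₗ (weightedSpace L x d).subtype) ∘ₗ
      (weightedHermite L x d).subtype) = hermiteSpace L x := by
  ext u
  rw [mem_hermiteSpace_iff hL hx hcd]
  exact ⟨fun ⟨f, hf⟩ => ⟨f, f.1.2, f.2, hf⟩, fun ⟨f, h1, h2, h3⟩ => ⟨⟨⟨f, h1⟩, h2⟩, h3⟩⟩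

lemma injective_reconstruct_weightedHermite (hx : IsPartition L x) {c d : Fin N → ℝ}
    (hcd : ∀ k, c k * d k = 1) :
    Function.Injective (((reconstruct L x d : L2 L →ₗ[ℝ] L2 L) ∘ₗ (weightedSpace L x d).subtype) ∘ₗ
      (weightedHermite L x d).subtype) :=
  ((injective_reconstruct hx hcd).comp Subtype.val_injective).comp Subtype.val_injective

lemma listsEigenvalues_hermiteSpace_iff (hL : 0 < L) (hx : IsPartition L x) {c d : Fin N → ℝ}
    (hcd : ∀ k, c k * d k = 1) {κ : ℝ → ℝ} (hκ : ∀ k, ∀ s ∈ elem x k, κ s = c k ^ 2)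
    {ι : Type} [Preorder ι] {lam : ι → ℝ} :
    ListsEigenvalues κ (hermiteSpace L x) lam ↔
      ListsFormEigenvalues (H := weightedHermite L x d) (restrictOp (bucklingOp L x d) (weightedHermite L x d)) lam := by
  refine listsEigenvalues_iff (H := weightedHermite L x d) _
    (injective_reconstruct_weightedHermite hx hcd) (range_reconstruct_weightedHermite hL hx hcd)
    (fun f k => ?_) (fun f k => ?_)
  · exact bendingForm_reconstruct hx hcd hκ ((f : weightedSpace L x d) : L2 L)
      ((k : weightedSpace L x d) : L2 L)
  · rw [restrictOp_apply, restrictOp_apply, bucklingOp_apply, bucklingOp_apply, ← bucklingForm_reconstruct]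
    rfl

lemma finrank_weightedHermite (hL : 0 < L) (hx : IsPartition L x) {c d : Fin N → ℝ}
    (hcd : ∀ k, c k * d k = 1) :
    Module.finrank ℝ (weightedHermite L x d) = Module.finrank ℝ (hermiteSpace L x) := by
  rw [← range_reconstruct_weightedHermite hL hx hcd,
    LinearMap.finrank_range_of_inj (injective_reconstruct_weightedHermite hx hcd)]

/-- The eigenvalue lists of the continuous and the discrete problem exist and satisfy the
two-sided bounds, for a stiffness `κ` with the constant value `τ k` on the element `k`. -/
theorem lists_and_bounds (hL : 0 < L) (hx : IsPartition L x) {κ : ℝ → ℝ} {τ : Fin N → ℝ}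
    (hτ : ∀ k, 0 < τ k) (hκ : ∀ k, ∀ s ∈ elem x k, κ s = τ k) {C : ℝ} (hC0 : 0 ≤ C)
    (hC : ∀ k, ((x k.succ - x k.castSucc) / (2 * Real.pi)) ^ 2 ≤ C * τ k) :
    (∃ lam : ℕ → ℝ, ListsEigenvalues κ (H20 L) lam) ∧
    (∃ lamh : Fin (Module.finrank ℝ (hermiteSpace L x)) → ℝ,
      ListsEigenvalues κ (hermiteSpace L x) lamh) ∧
    ∀ (lam : ℕ → ℝ) (lamh : Fin (Module.finrank ℝ (hermiteSpace L x)) → ℝ),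
      ListsEigenvalues κ (H20 L) lam → ListsEigenvalues κ (hermiteSpace L x) lamh →
      ∀ i, lamh i / (1 + lamh i * C) ≤ lam i ∧ lam i ≤ lamh i := by
  -- The square root distributes the stiffness evenly over the two arguments of the bending form.
  obtain ⟨c, d, hc, hcd⟩ : ∃ c d : Fin N → ℝ, (∀ k, c k ^ 2 = τ k) ∧ ∀ k, c k * d k = 1 :=
    ⟨fun k => Real.sqrt (τ k), fun k => (Real.sqrt (τ k))⁻¹, fun k => Real.sq_sqrt (hτ k).le,
      fun k => mul_inv_cancel₀ (Real.sqrt_pos.2 (hτ k)).ne'⟩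
  have hκ' : ∀ k, ∀ s ∈ elem x k, κ s = c k ^ 2 := fun k s hs => by rw [hc, hκ k s hs]
  have hBc := isCompactOperator_bucklingOp (x := x) hL d
  have hBi := injective_bucklingOp hx hcd
  refine ⟨?_, ?_, fun lam lamh h hh i => ?_⟩
  · obtain ⟨lam, h⟩ := exists_listsFormEigenvalues_nat
      (not_finiteDimensional_orthogonal (not_finiteDimensional_L2 hL) (momentSpan L x d)) hBc hBi
    exact ⟨lam, (listsEigenvalues_H20_iff hL hx hcd hκ').2 h⟩
  · obtain ⟨lam, h⟩ := exists_listsFormEigenvalues_fin (H := weightedHermite L x d)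
      (B := restrictOp (bucklingOp L x d) (weightedHermite L x d))
      (injective_restrictOp hBi _) (finrank_weightedHermite hL hx hcd)
    exact ⟨lam, (listsEigenvalues_hermiteSpace_iff hL hx hcd hκ').2 h⟩
  · refine eigenvalue_bounds hBc hBi (weightedHermite L x d) hC0 (fun f hf => ?_)
      ((listsEigenvalues_H20_iff hL hx hcd hκ').1 h)
      ((listsEigenvalues_hermiteSpace_iff hL hx hcd hκ').1 hh) i
    -- Orthogonality is given only against the piecewise affine functions within `weightedSpace`. It
    -- extends to all of them since the excluded directions, spanned by d and s d, are themselves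
    -- piecewise affine and orthogonal to f.
    have hf' : (f : L2 L) ∈ (pwAffine L x)ᗮ :=
      mem_orthogonal_of_inf (momentSpan_le hx d) f.2 fun u hu hu' =>
        (Submodule.mem_orthogonal (weightedHermite L x d) f).1 hf ⟨u, hu'⟩ hu
    exact norm_sq_le_of_orthogonal hx hcd hc hC hf'

/-- On a mesh that contains the steps, the thickness is constant and positive on each element. -/
lemma thickness_eq {r : ℕ} {y : Fin (r + 1) → ℝ} (hy : IsPartition L y) {t : ℝ → ℝ}
    {tseg : Fin r → ℝ} (htpos : ∀ j, 0 < tseg j)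
    (ht : ∀ j : Fin r, ∀ s ∈ Ioo (y j.castSucc) (y j.succ), t s = tseg j)
    (hx : IsPartition L x) (halign : ∀ j, ∃ k, y j = x k) (k : Fin N) :
    0 < elementThickness t x k ∧ ∀ s ∈ elem x k, t s = elementThickness t x k := by
  have hlt := hx.lt k
  -- No step lies strictly inside an element, so the segment containing the midpoint contains the
  -- whole element.
  have hno : ∀ i, y i ≤ x k.castSucc ∨ x k.succ ≤ y i := by
    intro i
    obtain ⟨l, hl⟩ := halign i
    rw [hl]
    rcases le_or_gt l k.castSucc with h | h
    · exact Or.inl (hx.strictMono.monotone h)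
    · exact Or.inr (hx.strictMono.monotone (Fin.castSucc_lt_iff_succ_le.1 h))
  have hm : (x k.castSucc + x k.succ) / 2 ∈ elem x k := ⟨by linarith, by linarith⟩
  obtain ⟨j, hj⟩ := hy.exists_elem (hx.elem_subset k hm) (by
    rintro ⟨i, hi⟩
    rcases hno i with h | h <;> rw [hi] at h <;> linarith [hm.1, hm.2])
  have h1 : y j.castSucc ≤ x k.castSucc := by
    rcases hno j.castSucc with h | h
    · exact h
    · linarith [hj.1, hm.2]
  have h2 : x k.succ ≤ y j.succ := by
    rcases hno j.succ with h | h
    · linarith [hj.2, hm.1]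
    · exact h
  have h3 : elementThickness t x k = tseg j := ht j _ hj
  refine ⟨h3 ▸ htpos j, fun s hs => ?_⟩
  rw [h3]
  exact ht j s ⟨h1.trans_lt hs.1, hs.2.trans_le h2⟩

lemma constSq_nonneg {t : ℝ → ℝ} (ht : ∀ k, 0 < elementThickness t x k) : 0 ≤ constSq t x :=
  mul_nonneg (by positivity) (Real.iSup_nonneg fun k =>
    div_nonneg (sq_nonneg _) (pow_pos (ht k) 3).le)

lemma sq_le_constSq_mul {t : ℝ → ℝ} (ht : ∀ k, 0 < elementThickness t x k) (k : Fin N) :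
    ((x k.succ - x k.castSucc) / (2 * Real.pi)) ^ 2 ≤
      constSq t x * elementThickness t x k ^ 3 := by
  have h1 := le_ciSup (f := fun k : Fin N =>
    (x k.succ - x k.castSucc) ^ 2 / elementThickness t x k ^ 3) (Set.finite_range _).bddAbove k
  have h2 := pow_pos (ht k) 3
  rw [div_le_iff₀ h2] at h1
  rw [constSq, mul_assoc, div_pow, mul_pow, div_eq_inv_mul, one_div]
  norm_num only
  exact mul_le_mul_of_nonneg_left h1 (by positivity)

end Main

end Beam

theorem mainTheorem6 (L : ℝ) (hL : 0 < L) (E b : ℝ) (hE : 0 < E) (hb : 0 < b)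
    -- the segments of the stepped beam, and its thickness
    (r : ℕ) (y : Fin (r + 1) → ℝ) (hy : Beam.IsPartition L y)
    (t : ℝ → ℝ) (tseg : Fin r → ℝ) (htpos : ∀ j, 0 < tseg j)
    (ht : ∀ j : Fin r, ∀ s ∈ Set.Ioo (y j.castSucc) (y j.succ), t s = tseg j)
    -- the finite element mesh, aligned with the segments
    (N : ℕ) (x : Fin (N + 1) → ℝ) (hx : Beam.IsPartition L x)
    (halign : ∀ j, ∃ k, y j = x k) :
    -- both eigenvalue problems of the scaled form have their list of eigenvalues
    (∃ lam : ℕ → ℝ, Beam.ListsEigenvalues (fun s => t s ^ 3) (Beam.H20 L) lam) ∧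
    (∃ lamh : Fin (Module.finrank ℝ (Beam.hermiteSpace L x)) → ℝ,
      Beam.ListsEigenvalues (fun s => t s ^ 3) (Beam.hermiteSpace L x) lamh) ∧
    -- they are the eigenvalues of the beam, scaled by `12 / (E b)`
    (∀ P : ℕ → ℝ, Beam.ListsEigenvalues (Beam.rectStiffness E b t) (Beam.H20 L) P ↔
      Beam.ListsEigenvalues (fun s => t s ^ 3) (Beam.H20 L) (fun i => 12 * P i / (E * b))) ∧
    (∀ Ph : Fin (Module.finrank ℝ (Beam.hermiteSpace L x)) → ℝ,
      Beam.ListsEigenvalues (Beam.rectStiffness E b t) (Beam.hermiteSpace L x) Ph ↔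
      Beam.ListsEigenvalues (fun s => t s ^ 3) (Beam.hermiteSpace L x)
        (fun i => 12 * Ph i / (E * b))) ∧
    -- the two-sided bounds
    (∀ (lam : ℕ → ℝ) (lamh : Fin (Module.finrank ℝ (Beam.hermiteSpace L x)) → ℝ),
      Beam.ListsEigenvalues (fun s => t s ^ 3) (Beam.H20 L) lam →
      Beam.ListsEigenvalues (fun s => t s ^ 3) (Beam.hermiteSpace L x) lamh →
      ∀ i, lamh i / (1 + lamh i * Beam.constSq t x) ≤ lam i ∧ lam i ≤ lamh i) := by
  have hthick := fun k => Beam.thickness_eq hy htpos ht hx halign k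
  obtain ⟨h1, h2, h3⟩ := Beam.lists_and_bounds hL hx (κ := fun s => t s ^ 3)
    (τ := fun k => Beam.elementThickness t x k ^ 3) (fun k => pow_pos (hthick k).1 3)
    (fun k s hs => by rw [(hthick k).2 s hs]) (Beam.constSq_nonneg fun k => (hthick k).1)
    (Beam.sq_le_constSq_mul fun k => (hthick k).1)
  -- The stiffness is E b/12 times t³, so the physical and the scaled lists differ by this factor
  -- alone.
  have ha : 0 < E * b / 12 := by positivity
  have hscale : ∀ p : ℝ, p / (E * b / 12) = 12 * p / (E * b) := fun p => by
    rw [div_div_eq_mul_div, mul_comm]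
  have hκ : ∀ s, Beam.rectStiffness E b t s = E * b / 12 * t s ^ 3 := fun s => by
    rw [Beam.rectStiffness]; ring
  refine ⟨h1, h2, fun P => ?_, fun P => ?_, h3⟩
  · rw [Beam.listsEigenvalues_const_mul ha hκ]
    simp only [hscale]
  · rw [Beam.listsEigenvalues_const_mul ha hκ]
    simp only [hscale]
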